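/- Let $G$ be a connected real Lie group of dimension $2m$, let $\Gamma\subset G$ be a discrete subgroup such that the quotient manifold $M=\Gamma\backslash G$ is compact, and let $J$ be an invariant almost complex structure on $M$, i.e. one induced by a left-invariant almost complex structure on $G$. Let $K_J=\Lambda^{m,0}$ be the canonical bundle of $(M,J)$, that is, the complex line bundle of complex-valued $(m,0)$-forms. For a smooth $(m,0)$-form $\Omega$, let $\bar\partial\Omega$ denote the $(m,1)$-component of $d\Omega$. For $l\ge 1$ extend $\bar\partial$ to smooth sections of $K_J^{\otimes l}$ by the Leibniz rule: if $\Omega$ is a smooth nowhere vanishing $(m,0)$-form on an open set and $f$ is a smooth complex-valued function there, $$\bar\partial(f\,\Omega^{\otimes l})=(\bar\partial f\wedge\Omega+l f\,\bar\partial\Omega)\otimes\Omega^{\otimes(l-1)},$$ where $\bar\partial f$ is the $(0,1)$-component of $df$. A smooth section $\sigma$ of $K_J^{\otimes l}$ is called pseudoholomorphic if $\bar\partial\sigma=0$; let $P_l$ be the complex vector space of pseudoholomorphic sections of $K_J^{\otimes l}$. The bundle $K_J^{\otimes l}$ is called pseudoholomorphically trivial if it has a nowhere vanishing pseudoholomorphic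 section. The Kodaira dimension of $(M,J)$ is $$\kappa_J=\begin{cases}-\infty & \text{if } P_l=\{0\}\text{ for all } l\ge 1,\\ \displaystyle\limsup_{l\to\infty}\frac{\log\dim_{\mathbb C}P_l}{\log l} & \text{otherwise,}\end{cases}$$ where $\log 0=-\infty$. If $K_J^{\otimes l}$ is pseudoholomorphically trivial for some $l\ge 1$, then $\kappa_J=0$. -/

import Mathlib

open scoped Manifold ContDiff Topology

noncomputable section

/-! ### Linear algebra of complex-valued alternating forms on a space with a complex structure -/

section Pointwise

variable {V : Type*} [AddCommGroup V] [Module ℝ V] [TopologicalSpace V]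

/-- The `ℂ`-multilinear extension of a real `k`-form `α : V^k → ℂ` to the complexification of `V`,
evaluated at the complex vectors `a j + i b j`. -/
def complexExtension {k : ℕ} (α : V [⋀^Fin k]→L[ℝ] ℂ) (a b : Fin k → V) : ℂ :=
  ∑ T : Finset (Fin k), Complex.I ^ T.card * α (T.piecewise b a)

/-- The component of type `(p, k - p)` of a `k`-form `α`, with respect to a complex structure `J`
on `V`: with `π¹⁰ v = (v - i J v) / 2` and `π⁰¹ v = (v + i J v) / 2`, it is the sum over all
`S ⊆ {1, …, k}` with `p` elements of the values of (the complex extension of) `α` at the vectors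
`π¹⁰ (v j)` for `j ∈ S` and `π⁰¹ (v j)` for `j ∉ S`. -/
def typeComponent (J : V →L[ℝ] V) {k : ℕ} (p : ℕ) (α : V [⋀^Fin k]→L[ℝ] ℂ) (v : Fin k → V) : ℂ :=
  ∑ S ∈ (Finset.univ : Finset (Fin k)).powersetCard p,
    complexExtension α (fun j => (1 / 2 : ℝ) • v j)
      (fun j => if j ∈ S then -((1 / 2 : ℝ) • J (v j)) else (1 / 2 : ℝ) • J (v j))

/-- The forms of type `(k, 0)`: the `k`-forms that are complex linear with respect to `J`. -/
def holomorphicForms (k : ℕ) (J : V →L[ℝ] V) : Submodule ℂ (V [⋀^Fin k]→L[ℝ] ℂ) where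
  carrier := {α | ∀ (v : Fin k → V) (j : Fin k),
    α (Function.update v j (J (v j))) = Complex.I * α v}
  add_mem' := by
    intro α β hα hβ v j
    simp [hα v j, hβ v j, mul_add]
  zero_mem' := by
    intro v j
    simp
  smul_mem' := by
    intro c α hα v j
    simp only [ContinuousAlternatingMap.smul_apply, hα v j, smul_eq_mul]
    ring

/-- The wedge product `β ∧ α` of a complex-valued `1`-form `β` and a `k`-form `α`. -/
def oneFormWedge {k : ℕ} (β : V → ℂ) (α : V [⋀^Fin k]→L[ℝ] ℂ) (v : Fin (k + 1) → V) : ℂ :=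
  ∑ i : Fin (k + 1), (-1) ^ (i : ℕ) * β (v i) * α (i.removeNth v)

end Pointwise

section Manifold

variable {E : Type*} [NormedAddCommGroup E] [NormedSpace ℝ E]
  {M : Type*} [TopologicalSpace M] [ChartedSpace E M]

/-! ### Differential forms on a manifold -/

/-- The expression of a complex-valued `k`-form `α` on `M` in the chart around `x₀`: the pullback
of `α` by the inverse of the chart. It is meaningful on the target of the chart. -/
def formInChart {k : ℕ} (α : Π x : M, TangentSpace 𝓘(ℝ, E) x [⋀^Fin k]→L[ℝ] ℂ) (x₀ : M) :
    E → E [⋀^Fin k]→L[ℝ] ℂ :=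
  fun y => (α ((chartAt E x₀).symm y)).compContinuousLinearMap
    (mfderiv 𝓘(ℝ, E) 𝓘(ℝ, E) (chartAt E x₀).symm y)

/-- Smoothness of a complex-valued `k`-form on an open set `U`. -/
def IsSmoothFormOn {k : ℕ} (α : Π x : M, TangentSpace 𝓘(ℝ, E) x [⋀^Fin k]→L[ℝ] ℂ)
    (U : Set M) : Prop :=
  ∀ x₀ : M, ContDiffOn ℝ ∞ (formInChart α x₀)
    ((chartAt E x₀).target ∩ (chartAt E x₀).symm ⁻¹' U)

/-- The exterior derivative of a `k`-form, computed at `x` in the chart around `x`. -/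
def extDerivForm {k : ℕ} (α : Π x : M, TangentSpace 𝓘(ℝ, E) x [⋀^Fin k]→L[ℝ] ℂ) (x : M) :
    TangentSpace 𝓘(ℝ, E) x [⋀^Fin (k + 1)]→L[ℝ] ℂ :=
  (extDeriv (formInChart α x) (chartAt E x x)).compContinuousLinearMap
    (mfderiv 𝓘(ℝ, E) 𝓘(ℝ, E) (chartAt E x) x)

end Manifold

/-! ### Almost complex manifolds and their Kodaira dimension -/

/-- A smooth almost complex structure on a manifold `M` modelled on `E`: a smooth endomorphism of
the tangent bundle with square `-1`. -/
structure AlmostComplexStructure (E : Type*) [NormedAddCommGroup E] [NormedSpace ℝ E]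
    (M : Type*) [TopologicalSpace M] [ChartedSpace E M] [IsManifold 𝓘(ℝ, E) ∞ M] where
  toFun : Π x : M, TangentSpace 𝓘(ℝ, E) x →L[ℝ] TangentSpace 𝓘(ℝ, E) x
  sq_eq_neg : ∀ (x : M) (v : TangentSpace 𝓘(ℝ, E) x), toFun x (toFun x v) = -v
  smooth : ContMDiff 𝓘(ℝ, E).tangent 𝓘(ℝ, E).tangent ∞
    (fun v : TangentBundle 𝓘(ℝ, E) M => (⟨v.1, toFun v.1 v.2⟩ : TangentBundle 𝓘(ℝ, E) M))

namespace AlmostComplexStructure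

variable {E : Type*} [NormedAddCommGroup E] [NormedSpace ℝ E]
  {M : Type*} [TopologicalSpace M] [ChartedSpace E M] [IsManifold 𝓘(ℝ, E) ∞ M]

/-- The fibre at `x` of the canonical bundle `K_J = Λ^{m,0}` of an almost complex `2m`-manifold. -/
abbrev CanonicalFiber (m : ℕ) (J : AlmostComplexStructure E M) (x : M) : Type _ :=
  holomorphicForms m (J.toFun x)

/-- The fibre at `x` of the tensor power `K_J^{⊗ l}` of the canonical bundle. -/
abbrev PluricanonicalFiber (m : ℕ) (J : AlmostComplexStructure E M) (l : ℕ) (x : M) : Type _ :=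
  PiTensorProduct ℂ (fun _ : Fin l => J.CanonicalFiber m x)

/-- The differential `df` at `x` of a complex-valued function `f`. -/
def differential (f : M → ℂ) (x : M) : TangentSpace 𝓘(ℝ, E) x →L[ℝ] ℂ :=
  mfderiv 𝓘(ℝ, E) 𝓘(ℝ, ℂ) f x

/-- `∂̄ f`, the component of type `(0,1)` of `df`, for a complex-valued function `f`. -/
def delbarFun (J : AlmostComplexStructure E M) (f : M → ℂ) (x : M)
    (v : TangentSpace 𝓘(ℝ, E) x) : ℂ :=
  (differential f x v + Complex.I * differential f x (J.toFun x v)) / 2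

/-- `∂̄ Ω`, the component of type `(m,1)` of `dΩ`, for an `(m,0)`-form `Ω`. -/
def delbarForm {m : ℕ} (J : AlmostComplexStructure E M) (Ω : Π x : M, J.CanonicalFiber m x)
    (x : M) (v : Fin (m + 1) → TangentSpace 𝓘(ℝ, E) x) : ℂ :=
  typeComponent (J.toFun x) m (extDerivForm (fun y => (Ω y).1) x) v

/-- `Ω` is a smooth local frame of the canonical bundle on the open set `U`, that is, a smooth
nowhere vanishing `(m,0)`-form on `U`. -/
structure IsLocalFrame {m : ℕ} (J : AlmostComplexStructure E M) (U : Set M)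
    (Ω : Π x : M, J.CanonicalFiber m x) : Prop where
  isOpen : IsOpen U
  smooth : IsSmoothFormOn (fun x => (Ω x).1) U
  ne_zero : ∀ x ∈ U, Ω x ≠ 0

/-- A smooth section `σ` of `K_J^{⊗ l}` is pseudoholomorphic if `∂̄ σ = 0`, where `∂̄` is extended
from `(m,0)`-forms to tensor powers by the Leibniz rule. In a local frame `Ω` of `K_J` on `U` one
has `σ = f Ω^{⊗ l}` with `f` smooth, and
`∂̄ (f Ω^{⊗ l}) = (∂̄ f ∧ Ω + l f ∂̄ Ω) ⊗ Ω^{⊗ (l - 1)}`. -/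
def IsPseudoholomorphic {m : ℕ} (J : AlmostComplexStructure E M) (l : ℕ)
    (σ : Π x : M, J.PluricanonicalFiber m l x) : Prop :=
  ∀ (U : Set M) (Ω : Π x : M, J.CanonicalFiber m x), J.IsLocalFrame U Ω →
    ∃ f : M → ℂ, ContMDiffOn 𝓘(ℝ, E) 𝓘(ℝ, ℂ) ∞ f U ∧
      (∀ x ∈ U, σ x = f x • PiTensorProduct.tprod ℂ (fun _ : Fin l => Ω x)) ∧
      ∀ x ∈ U, ∀ v : Fin (m + 1) → TangentSpace 𝓘(ℝ, E) x,
        oneFormWedge (J.delbarFun f x) (Ω x).1 v + l * f x * J.delbarForm Ω x v = 0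

/-- The complex vector space `P_l` of pseudoholomorphic sections of `K_J^{⊗ l}`. -/
def pseudoholomorphicSections (m : ℕ) (J : AlmostComplexStructure E M) (l : ℕ) :
    Submodule ℂ (Π x : M, J.PluricanonicalFiber m l x) where
  carrier := {σ | J.IsPseudoholomorphic l σ}
  add_mem' := by
    intro σ τ hσ hτ U Ω hΩ
    obtain ⟨f, hf, hfσ, hf0⟩ := hσ U Ω hΩ
    obtain ⟨g, hg, hgτ, hg0⟩ := hτ U Ω hΩ
    refine ⟨f + g, hf.add hg, fun x hx => ?_, fun x hx v => ?_⟩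
    · simp [hfσ x hx, hgτ x hx, add_smul]
    · have hfx : MDifferentiableAt 𝓘(ℝ, E) 𝓘(ℝ, ℂ) f x :=
        (hf.contMDiffAt (hΩ.isOpen.mem_nhds hx)).mdifferentiableAt (by simp)
      have hgx : MDifferentiableAt 𝓘(ℝ, E) 𝓘(ℝ, ℂ) g x :=
        (hg.contMDiffAt (hΩ.isOpen.mem_nhds hx)).mdifferentiableAt (by simp)
      have hadd : ∀ w, J.delbarFun (f + g) x w = J.delbarFun f x w + J.delbarFun g x w := by
        intro w
        have h := (hfx.hasMFDerivAt.add hgx.hasMFDerivAt).mfderiv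
        have h1 : ∀ u : TangentSpace 𝓘(ℝ, E) x,
            differential (f + g) x u = differential f x u + differential g x u :=
          fun u => congrArg (fun L => L u) h
        simp only [delbarFun, h1]
        ring
      have hw : oneFormWedge (J.delbarFun (f + g) x) (Ω x).1 v =
          oneFormWedge (J.delbarFun f x) (Ω x).1 v + oneFormWedge (J.delbarFun g x) (Ω x).1 v := by
        simp only [oneFormWedge, hadd, ← Finset.sum_add_distrib]
        exact Finset.sum_congr rfl fun i _ => by ring
      rw [hw, Pi.add_apply]
      linear_combination hf0 x hx v + hg0 x hx v
  zero_mem' := by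
    intro U Ω hΩ
    refine ⟨fun _ => 0, contMDiffOn_const, fun x _ => by simp, fun x _ v => ?_⟩
    have h0 : ∀ w, J.delbarFun (fun _ => (0 : ℂ)) x w = 0 := by
      intro w
      simp only [delbarFun, differential, mfderiv_const]
      change ((0 : ℂ) + Complex.I * 0) / 2 = 0
      simp
    simp [oneFormWedge, h0]
  smul_mem' := by
    intro c σ hσ U Ω hΩ
    obtain ⟨f, hf, hfσ, hf0⟩ := hσ U Ω hΩ
    have hfun : (fun x => c * f x) = (fun z : ℂ => c * z) ∘ f := rfl
    refine ⟨fun x => c * f x, ?_, fun x hx => ?_, fun x hx v => ?_⟩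
    · exact (contDiff_const.mul contDiff_id).contMDiff.comp_contMDiffOn hf
    · simp [hfσ x hx, mul_smul]
    · have hfx : MDifferentiableAt 𝓘(ℝ, E) 𝓘(ℝ, ℂ) f x :=
        (hf.contMDiffAt (hΩ.isOpen.mem_nhds hx)).mdifferentiableAt (by simp)
      have hc : ∀ w, J.delbarFun (fun x => c * f x) x w = c * J.delbarFun f x w := by
        intro w
        have h2 : HasMFDerivAt 𝓘(ℝ, ℂ) 𝓘(ℝ, ℂ) (fun z : ℂ => c * z) (f x)
            (ContinuousLinearMap.mul ℝ ℂ c) :=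
          ((ContinuousLinearMap.mul ℝ ℂ c).hasFDerivAt).hasMFDerivAt
        have h := (h2.comp x hfx.hasMFDerivAt).mfderiv
        have h1 : ∀ u : TangentSpace 𝓘(ℝ, E) x,
            differential (fun x => c * f x) x u = c * differential f x u :=
          fun u => congrArg (fun L => L u) h
        simp only [delbarFun, h1]
        ring
      have hw : oneFormWedge (J.delbarFun (fun x => c * f x) x) (Ω x).1 v =
          c * oneFormWedge (J.delbarFun f x) (Ω x).1 v := by
        simp only [oneFormWedge, hc, Finset.mul_sum]
        exact Finset.sum_congr rfl fun i _ => by ring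
      rw [hw]
      linear_combination c * hf0 x hx v

/-- `K_J^{⊗ l}` is pseudoholomorphically trivial: it has a pseudoholomorphic section that vanishes
nowhere. -/
def IsPseudoholomorphicallyTrivial (m : ℕ) (J : AlmostComplexStructure E M) (l : ℕ) : Prop :=
  ∃ σ ∈ J.pseudoholomorphicSections m l, ∀ x : M, σ x ≠ 0

/-- The Kodaira dimension of an almost complex `2m`-manifold: `-∞` if `P_l = 0` for all `l ≥ 1`, and
otherwise the upper limit of `log (dim P_l) / log l`, with `log 0 = -∞` (and `log ∞ = ∞`). -/
def kodairaDimension (m : ℕ) (J : AlmostComplexStructure E M) : EReal :=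
  open Classical in
  if ∀ l : ℕ, 1 ≤ l → J.pseudoholomorphicSections m l = ⊥ then ⊥
  else Filter.limsup (fun l : ℕ =>
    ENNReal.log ((Cardinal.toENat (Module.rank ℂ (J.pseudoholomorphicSections m l)) : ℕ∞) : ENNReal)
      / ((Real.log l : ℝ) : EReal)) Filter.atTop

end AlmostComplexStructure

/-! ### Quotients of Lie groups by discrete subgroups -/

/-- The quotient `Γ \ G` of a group `G` by the left multiplication action of a subgroup `Γ`. The
parameter `E` is the model space of the smooth structures. -/
def LieQuotient (_E : Type*) {G : Type*} [Group G] (Γ : Subgroup G) : Type _ :=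
  MulAction.orbitRel.Quotient Γ G

namespace LieQuotient

variable (E : Type*) {G : Type*} [Group G] (Γ : Subgroup G)

instance [TopologicalSpace G] : TopologicalSpace (LieQuotient E Γ) :=
  inferInstanceAs (TopologicalSpace (MulAction.orbitRel.Quotient Γ G))

/-- The projection `G → Γ \ G`. -/
def proj (g : G) : LieQuotient E Γ := Quotient.mk (MulAction.orbitRel Γ G) g

theorem proj_eq_iff {g h : G} : proj E Γ g = proj E Γ h ↔ ∃ γ ∈ Γ, γ * h = g := by
  have h0 : proj E Γ g = proj E Γ h ↔ (MulAction.orbitRel Γ G) g h := Quotient.eq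
  rw [h0, MulAction.orbitRel_apply, MulAction.mem_orbit_iff]
  simp [Subgroup.smul_def]

theorem proj_surjective : Function.Surjective (proj E Γ) := Quotient.mk_surjective

variable [TopologicalSpace G] [NormedAddCommGroup E] [NormedSpace ℝ E] [ChartedSpace E G]
  [LieGroup 𝓘(ℝ, E) ∞ G] [DiscreteTopology Γ]

theorem isLocalHomeomorph_proj : IsLocalHomeomorph (proj E Γ) := by
  have : IsTopologicalGroup G := topologicalGroup_of_lieGroup 𝓘(ℝ, E) ∞
  refine (Topology.IsQuotientMap.isQuotientCoveringMap_of_subgroup (f := proj E Γ)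
    isQuotientMap_quotient_mk' Γ ⟨inferInstance⟩ ?_).isCoveringMap.isLocalHomeomorph
  intro a b
  rw [eq_comm, proj_eq_iff]
  constructor
  · rintro ⟨γ, hγ, rfl⟩
    simpa using hγ
  · intro h
    exact ⟨_, h, by simp⟩

/-- The charts of `Γ \ G` are the local inverses of the projection composed with charts of `G`. -/
instance : ChartedSpace E (LieQuotient E Γ) :=
  (isLocalHomeomorph_proj E Γ).chartedSpace (proj_surjective E Γ)

/-- Local sections of the projection are locally left translates of each other. -/
theorem localInverse_eventuallyEq (b z₀ : G)
    (hz : proj E Γ z₀ ∈ ((isLocalHomeomorph_proj E Γ).localInverseAt b).source) :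
    ∃ γ : G, ∀ᶠ z in 𝓝 z₀,
      (isLocalHomeomorph_proj E Γ).localInverseAt b (proj E Γ z) = γ * z := by
  have : IsTopologicalGroup G := topologicalGroup_of_lieGroup 𝓘(ℝ, E) ∞
  set H := isLocalHomeomorph_proj E Γ
  set s := H.localInverseAt b with hs
  have hsymm : ∀ g, s.symm g = proj E Γ g := fun g => by
    rw [hs, IsLocalHomeomorph.localInverseAt_symm]
  have h1 : proj E Γ (s (proj E Γ z₀)) = proj E Γ z₀ := by
    rw [← hsymm]; exact s.left_inv hz
  obtain ⟨γ, hγ, h2⟩ := (proj_eq_iff E Γ).1 h1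
  refine ⟨γ, ?_⟩
  have h3 : ∀ᶠ z in 𝓝 z₀, γ * z ∈ s.target :=
    (continuous_const_mul γ).continuousAt.eventually_mem
      (s.open_target.mem_nhds (by rw [h2]; exact s.map_source hz))
  filter_upwards [h3] with z hz'
  have h4 : proj E Γ (γ * z) = proj E Γ z := (proj_eq_iff E Γ).2 ⟨γ, hγ, rfl⟩
  rw [← h4, ← hsymm]
  exact s.right_inv hz'

instance : IsManifold 𝓘(ℝ, E) ∞ (LieQuotient E Γ) := by
  apply isManifold_of_contDiffOn
  rintro _ _ ⟨p, rfl⟩ ⟨q, rfl⟩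
  set H := isLocalHomeomorph_proj E Γ
  set a := (proj_surjective E Γ).hasRightInverse.choose p
  set b := (proj_surjective E Γ).hasRightInverse.choose q
  intro y hy
  have hy' := hy.1
  simp only [modelWithCornersSelf_coe_symm, Set.preimage_id, OpenPartialHomeomorph.trans_source,
    OpenPartialHomeomorph.symm_source, OpenPartialHomeomorph.trans_target,
    OpenPartialHomeomorph.coe_trans_symm, Set.mem_inter_iff, Set.mem_preimage,
    Function.comp_apply, IsLocalHomeomorph.localInverseAt_symm] at hy'
  obtain ⟨⟨hy1, hy2⟩, hy3, hy4⟩ := hy'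
  obtain ⟨γ, hγ⟩ := localInverse_eventuallyEq E Γ b ((chartAt E a).symm y) hy3
  have hcont : ContinuousAt (chartAt E a).symm y :=
    (chartAt E a).continuousAt_symm hy1
  have hγ' := hcont.eventually hγ
  have hsm : ContMDiffAt 𝓘(ℝ, E) 𝓘(ℝ, E) ∞
      (fun w => chartAt E b (γ * (chartAt E a).symm w)) y := by
    have e1 : ContMDiffAt 𝓘(ℝ, E) 𝓘(ℝ, E) ∞ (chartAt E a).symm y :=
      contMDiffOn_chart_symm.contMDiffAt ((chartAt E a).open_target.mem_nhds hy1)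
    have e2 : ContMDiffAt 𝓘(ℝ, E) 𝓘(ℝ, E) ∞ (fun w => γ * (chartAt E a).symm w) y :=
      (contMDiff_mul_left (I := 𝓘(ℝ, E)) (n := ∞) (a := γ)).contMDiffAt.comp y e1
    have e3 : γ * (chartAt E a).symm y ∈ (chartAt E b).source := by
      rw [← hγ.self_of_nhds]; exact hy4
    exact (contMDiffOn_chart.contMDiffAt ((chartAt E b).open_source.mem_nhds e3)).comp y e2
  refine ((contMDiffAt_iff_contDiffAt.1 hsm).congr_of_eventuallyEq ?_).contDiffWithinAt
  filter_upwards [hγ'] with w hw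
  simp only [modelWithCornersSelf_coe, modelWithCornersSelf_coe_symm, Function.comp_apply, id,
    OpenPartialHomeomorph.coe_trans, OpenPartialHomeomorph.coe_trans_symm,
    IsLocalHomeomorph.localInverseAt_symm]
  exact congrArg _ hw

variable {E Γ} in
/-- An almost complex structure on `Γ \ G` is invariant if it is induced by a left-invariant one on
`G`: there is an endomorphism `j` of the Lie algebra of `G` such that the projection intertwines
the left-invariant endomorphism of `TG` given by `j` with `J`. -/
def IsInvariant (J : AlmostComplexStructure E (LieQuotient E Γ)) : Prop :=
  ∃ j : GroupLieAlgebra 𝓘(ℝ, E) G →L[ℝ] GroupLieAlgebra 𝓘(ℝ, E) G,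
    ∀ (g : G) (v : GroupLieAlgebra 𝓘(ℝ, E) G),
      mfderiv 𝓘(ℝ, E) 𝓘(ℝ, E) (proj E Γ) g (mulInvariantVectorField (j v) g) =
        J.toFun (proj E Γ g)
          (mfderiv 𝓘(ℝ, E) 𝓘(ℝ, E) (proj E Γ) g (mulInvariantVectorField v g))

end LieQuotient

end

/-!
The theorem holds on every compact connected almost complex manifold `M` on which some
`K_J^{⊗ l}`, `l ≥ 1`, has a nowhere vanishing pseudoholomorphic section `σ`: then each `P_n`,
`n ≥ 1`, has dimension at most one, and `P_{l k}` has dimension exactly one.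

The analytic input is that a function `f : M → ℂ` with `∂̄ f = 0` is constant
(`AlmostComplexStructure.eq_const_of_delbarFun_eq_zero`). In a chart, the real and imaginary parts
satisfy `du ∘ J = -dv`, and the symmetry of the second derivative of `v` yields, for every
direction `X`, the equation `D²u(X, X) + D²u(J X, J X) = du(b)` with `b` built from `J` and its
first derivative (`fderiv_fderiv_add_of_comp_eq_neg`). This is enough for a strong maximum
principle by comparison with a steep Gaussian, testing the equation only in the radial direction
(`eq_of_le_of_comp_eq_neg`); so the set where `u` attains its maximum is open and closed.

If `τ ∈ P_n` and `σ ∈ P_n` vanishes nowhere, then the quotient `τ / σ` is pseudoholomorphic: the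
Leibniz rule gives `∂̄ (τ / σ) ∧ Ω = 0` for a local frame `Ω`, and wedging a `(0,1)`-form with a
nonzero `(m,0)`-form is injective (`eq_zero_of_oneFormWedge_eq_zero`). Hence `τ` is a constant
multiple of `σ`. For general `n`, the `l`-th power of a nonzero `τ ∈ P_n` and the `n`-th power of
the trivializing section both lie in `P_{l n}`, so they are proportional, and `τ` vanishes nowhere;
any two elements of `P_n` are then proportional. Since pseudoholomorphy is tested on local frames of
`K_J`, these have to be constructed near every point (`exists_isLocalFrame`): a nonzero
`(m,0)`-form at `p`, which exists because `σ` does not vanish at `p`, is pulled back to nearby points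
by complex linear maps.
-/

/-! ### The strong maximum principle for pseudoholomorphic functions -/

section MaximumPrinciple

/-- The second derivative test along a line, as a necessary condition. -/
theorem IsLocalMax.sndDeriv_nonpos {φ ψ : ℝ → ℝ} {a t₀ : ℝ} (hmax : IsLocalMax φ t₀)
    (hφ : ∀ᶠ t in 𝓝 t₀, HasDerivAt φ (ψ t) t) (hψ : HasDerivAt ψ a t₀) : a ≤ 0 := by
  by_contra! ha
  have hd : deriv φ =ᶠ[𝓝 t₀] ψ := hφ.mono fun t ht => ht.deriv
  have hdd : deriv (deriv φ) t₀ = a := by rw [hd.deriv_eq, hψ.deriv]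
  have hmin : IsLocalMin φ t₀ :=
    isLocalMin_of_deriv_deriv_pos (by rw [hdd]; exact ha) hmax.deriv_eq_zero
      hφ.self_of_nhds.continuousAt
  have hconst : φ =ᶠ[𝓝 t₀] fun _ => φ t₀ := by
    filter_upwards [hmax, hmin] with t h1 h2 using le_antisymm h1 h2
  have h0 : deriv (deriv φ) t₀ = 0 := by
    have h1 : deriv φ =ᶠ[𝓝 t₀] deriv (fun _ => φ t₀) := hconst.deriv
    rw [h1.deriv_eq]
    simp
  linarith

variable {E : Type*} [NormedAddCommGroup E] [NormedSpace ℝ E]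

/-- If `du ∘ J = -dv`, then `u` satisfies, in each direction `X`, a second order equation without
zeroth order term. It expresses the symmetry of the second derivative of `v` on the pair
`(X, J X)`. -/
theorem fderiv_fderiv_add_of_comp_eq_neg {u v : E → ℝ} {J : E → E →L[ℝ] E} {x : E}
    (hu : ContDiffAt ℝ 2 u x) (hv : ContDiffAt ℝ 2 v x) (hJ : DifferentiableAt ℝ J x)
    (hJ2 : ∀ w, J x (J x w) = -w)
    (h : ∀ᶠ z in 𝓝 x, ∀ w, fderiv ℝ u z (J z w) = -fderiv ℝ v z w) (X : E) :
    fderiv ℝ (fderiv ℝ u) x X X + fderiv ℝ (fderiv ℝ u) x (J x X) (J x X) =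
      fderiv ℝ u x (fderiv ℝ J x X (J x X) - fderiv ℝ J x (J x X) X) := by
  have hdu : DifferentiableAt ℝ (fderiv ℝ u) x :=
    (hu.fderiv_right (m := 1) (by norm_num)).differentiableAt (by norm_num)
  have heq : (fun z => (fderiv ℝ u z).comp (J z)) =ᶠ[𝓝 x] fun z => -fderiv ℝ v z := by
    filter_upwards [h] with z hz
    ext w
    exact hz w
  have hd := heq.fderiv_eq (𝕜 := ℝ)
  have hsymm : IsSymmSndFDerivAt ℝ v x := hv.isSymmSndFDerivAt (by simp)
  have key : ∀ a b, fderiv ℝ (fderiv ℝ u) x a (J x b) + fderiv ℝ u x (fderiv ℝ J x a b) =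
      -fderiv ℝ (fderiv ℝ v) x a b := by
    intro a b
    have h1 := (hdu.hasFDerivAt.clm_comp hJ.hasFDerivAt).fderiv
    have h3 : fderiv ℝ (fun z => -fderiv ℝ v z) x = -fderiv ℝ (fderiv ℝ v) x := fderiv_fun_neg
    rw [h1, h3] at hd
    have h2 := congrArg (fun L => L a b) hd
    simp at h2
    linarith
  have k1 := key X (J x X)
  have k2 := key (J x X) X
  rw [hsymm.eq X (J x X)] at k1
  rw [hJ2, map_neg] at k1
  rw [map_sub]
  linarith

variable {F : Type*} [NormedAddCommGroup F] [InnerProductSpace ℝ F]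

/-- First and second derivative at an interior maximum of `u + ε exp (-α ‖L (x - y)‖ ^ 2)`. -/
theorem derivs_at_max_add_gaussian (L : E →L[ℝ] F) {u : E → ℝ} {x y : E} {ε α : ℝ}
    (hu : ContDiffAt ℝ 2 u x)
    (hmax : IsLocalMax (fun z => u z + ε * Real.exp (-α * ‖L (z - y)‖ ^ 2)) x) (V : E) :
    fderiv ℝ u x V =
        ε * (2 * α * inner ℝ (L (x - y)) (L V)) * Real.exp (-α * ‖L (x - y)‖ ^ 2) ∧
      fderiv ℝ (fderiv ℝ u) x V V + ε * (4 * α ^ 2 * inner ℝ (L (x - y)) (L V) ^ 2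
        - 2 * α * ‖L V‖ ^ 2) * Real.exp (-α * ‖L (x - y)‖ ^ 2) ≤ 0 := by
  set A := ‖L (x - y)‖ ^ 2 with hA
  set B := inner ℝ (L (x - y)) (L V) with hB
  set C := ‖L V‖ ^ 2 with hC
  have hline : ∀ t : ℝ, HasDerivAt (fun t : ℝ => x + t • V) V t := fun t => by
    simpa using ((hasDerivAt_id t).smul_const V).const_add x
  have hcont : Filter.Tendsto (fun t : ℝ => x + t • V) (𝓝 0) (𝓝 x) := by
    have := (hline 0).continuousAt.tendsto
    simpa using this
  have hq : ∀ t : ℝ, ‖L (x + t • V - y)‖ ^ 2 = A + 2 * B * t + C * t ^ 2 := by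
    intro t
    have : L (x + t • V - y) = L (x - y) + t • L V := by
      rw [← map_smul, ← map_add]; congr 1; abel
    rw [this, norm_add_sq_real, norm_smul, real_inner_smul_right, mul_pow, Real.norm_eq_abs, sq_abs]
    ring
  set φ : ℝ → ℝ := fun t => u (x + t • V) + ε * Real.exp (-α * (A + 2 * B * t + C * t ^ 2)) with hφ
  have hmaxφ : IsLocalMax φ 0 := by
    have : φ = (fun z => u z + ε * Real.exp (-α * ‖L (z - y)‖ ^ 2)) ∘ fun t : ℝ => x + t • V := by
      funext t
      simp only [hφ, Function.comp, hq]
    rw [this]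
    filter_upwards [hcont.eventually hmax] with t ht
    simpa using ht
  clear_value A B C
  set ψ : ℝ → ℝ := fun t => fderiv ℝ u (x + t • V) V +
    ε * (Real.exp (-α * (A + 2 * B * t + C * t ^ 2)) * (-α * (2 * B + 2 * C * t))) with hψ
  have hpoly : ∀ t : ℝ, HasDerivAt (fun t : ℝ => -α * (A + 2 * B * t + C * t ^ 2))
      (-α * (2 * B + 2 * C * t)) t := by
    intro t
    have h1 := ((((hasDerivAt_id t).const_mul (2 * B)).const_add A).add
      ((hasDerivAt_pow 2 t).const_mul C)).const_mul (-α)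
    refine h1.congr_deriv ?_
    push_cast
    ring
  have hφ' : ∀ᶠ t in 𝓝 (0 : ℝ), HasDerivAt φ (ψ t) t := by
    have h1 : ∀ᶠ z in 𝓝 x, DifferentiableAt ℝ u z :=
      (hu.eventually (by simp)).mono fun z hz => hz.differentiableAt (by norm_num)
    filter_upwards [hcont.eventually h1] with t ht
    exact (ht.hasFDerivAt.comp_hasDerivAt t (hline t)).add (((hpoly t).exp).const_mul ε)
  have hdu : DifferentiableAt ℝ (fderiv ℝ u) x :=
    (hu.fderiv_right (m := 1) (by norm_num)).differentiableAt (by norm_num)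
  have hψ' : HasDerivAt ψ (fderiv ℝ (fderiv ℝ u) x V V +
      ε * (4 * α ^ 2 * B ^ 2 - 2 * α * C) * Real.exp (-α * A)) 0 := by
    have h0 : HasFDerivAt (fderiv ℝ u) (fderiv ℝ (fderiv ℝ u) x) (x + (0 : ℝ) • V) := by
      simpa using hdu.hasFDerivAt
    have h1 : HasDerivAt (fun t : ℝ => fderiv ℝ u (x + t • V) V)
        (fderiv ℝ (fderiv ℝ u) x V V) 0 := by
      exact (ContinuousLinearMap.apply ℝ ℝ V).hasFDerivAt.comp_hasDerivAt (0 : ℝ)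
        (h0.comp_hasDerivAt (0 : ℝ) (hline 0))
    have h2 : HasDerivAt (fun t : ℝ => -α * (2 * B + 2 * C * t)) (-α * (2 * C)) 0 := by
      have := (((hasDerivAt_id (0 : ℝ)).const_mul (2 * C)).const_add (2 * B)).const_mul (-α)
      simpa using this
    have h3 := ((hpoly 0).exp.mul h2).const_mul ε
    refine (h1.add h3).congr_deriv ?_
    simp only [mul_zero, add_zero, ne_eq, OfNat.ofNat_ne_zero, not_false_eq_true, zero_pow]
    ring
  refine ⟨?_, hmaxφ.sndDeriv_nonpos hφ' hψ'⟩
  have h0 : ψ 0 = 0 := hmaxφ.hasDerivAt_eq_zero hφ'.self_of_nhds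
  simp only [hψ, zero_smul, mul_zero, add_zero, ne_eq, OfNat.ofNat_ne_zero, not_false_eq_true,
    zero_pow] at h0
  linarith

/-- A strong maximum principle in the form in which it propagates from `x₀` to the centre `y` of a
ball around it. If `u y < c`, then on an annulus `ρ ≤ ‖L (x - y)‖ ≤ S` the perturbation of `u` by a
small multiple of a steep Gaussian centred at `y` attains its maximum in the interior; there the
second order equation of `fderiv_fderiv_add_of_comp_eq_neg` in the radial direction `X = x - y` is
violated. -/
theorem eq_of_le_of_comp_eq_neg [FiniteDimensional ℝ E] (L : E ≃L[ℝ] F) {U : Set E}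
    (hU : IsOpen U) {u v : E → ℝ} {J : E → E →L[ℝ] E} (hu : ContDiffOn ℝ 2 u U)
    (hv : ContDiffOn ℝ 2 v U) (hJ : ContDiffOn ℝ 1 J U) (hJ2 : ∀ x ∈ U, ∀ w, J x (J x w) = -w)
    (h : ∀ x ∈ U, ∀ w, fderiv ℝ u x (J x w) = -fderiv ℝ v x w) {c : ℝ} (hc : ∀ x ∈ U, u x ≤ c)
    {x₀ y : E} {S : ℝ} (hS : ∀ x, ‖L (x - y)‖ ≤ S → x ∈ U) (hx₀ : ‖L (x₀ - y)‖ < S)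
    (hux₀ : u x₀ = c) : u y = c := by
  have hS0 : 0 < S := (norm_nonneg _).trans_lt hx₀
  have hyU : y ∈ U := hS y (by simpa using hS0.le)
  have hcont : Continuous fun x => ‖L (x - y)‖ :=
    (L.continuous.comp (continuous_id.sub continuous_const)).norm
  refine le_antisymm (hc y hyU) ?_
  by_contra! hlt
  -- a small ball around `y` on which `u` stays below `c` by a definite amount
  obtain ⟨ρ, hρ0, hρ⟩ : ∃ ρ > 0, ∀ x, ‖L (x - y)‖ ≤ ρ → u x < (u y + c) / 2 := by
    have h1 : ∀ᶠ x in 𝓝 y, u x < (u y + c) / 2 :=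
      (hu.continuousOn.continuousAt (hU.mem_nhds hyU)).eventually_lt_const (by linarith)
    have h2 : Filter.Tendsto (fun z => y + L.symm z) (𝓝 0) (𝓝 y) := by
      have : Continuous fun z => y + L.symm z := continuous_const.add L.symm.continuous
      simpa using this.tendsto 0
    obtain ⟨r, hr, hr'⟩ := Metric.eventually_nhds_iff.1 (h2.eventually h1)
    refine ⟨r / 2, half_pos hr, fun x hx => ?_⟩
    have := @hr' (L (x - y)) (by rw [dist_zero_right]; linarith)
    simpa using this
  have hρx₀ : ρ < ‖L (x₀ - y)‖ := by
    by_contra! hle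
    have := hρ x₀ hle
    linarith
  -- the closed ball of radius `S` and a bound for the lower order terms on it
  set K : Set E := {x | ‖L (x - y)‖ ≤ S} with hK
  have hKc : IsCompact K := by
    have : FiniteDimensional ℝ F := L.toLinearEquiv.finiteDimensional
    have h1 : K = (fun z => y + L.symm z) '' Metric.closedBall 0 S := by
      ext x
      simp only [hK, Set.mem_ofPred_eq, Set.mem_image, Metric.mem_closedBall, dist_zero_right]
      constructor
      · intro hx
        exact ⟨L (x - y), hx, by simp⟩
      · rintro ⟨z, hz, rfl⟩
        simpa using hz
    rw [h1]
    exact (isCompact_closedBall 0 S).image (continuous_const.add L.symm.continuous)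
  set b : E → E := fun x =>
    fderiv ℝ J x (x - y) (J x (x - y)) - fderiv ℝ J x (J x (x - y)) (x - y) with hb
  have hbc : ContinuousOn (fun x => ‖L (x - y)‖ ^ 2 + ‖L (J x (x - y))‖ ^ 2
      - inner ℝ (L (x - y)) (L (b x))) K := by
    have hJc : ContinuousOn J K := hJ.continuousOn.mono hS
    have hdJ : ContinuousOn (fderiv ℝ J) K :=
      (hJ.continuousOn_fderiv_of_isOpen hU le_rfl).mono hS
    have hX : ContinuousOn (fun x => x - y) K := (continuous_id.sub continuous_const).continuousOn
    have hJX : ContinuousOn (fun x => J x (x - y)) K := hJc.clm_apply hX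
    have hb' : ContinuousOn b K :=
      ((hdJ.clm_apply hX).clm_apply hJX).sub ((hdJ.clm_apply hJX).clm_apply hX)
    have hL : ∀ {f : E → E}, ContinuousOn f K → ContinuousOn (fun x => L (f x)) K :=
      fun hf => L.continuous.comp_continuousOn hf
    exact (((hL hX).norm.pow 2).add ((hL hJX).norm.pow 2)).sub ((hL hX).inner (hL hb'))
  obtain ⟨N, hN⟩ := hKc.bddAbove_image hbc
  set α : ℝ := (|N| + 1) / (2 * ρ ^ 4) with hα
  have hα0 : 0 < α := by positivity
  set g : E → ℝ := fun x => Real.exp (-α * ‖L (x - y)‖ ^ 2) with hg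
  set ε : ℝ := (c - u y) / 2 with hε
  have hε0 : 0 < ε := by rw [hε]; linarith
  set w : E → ℝ := fun x => u x + ε * g x with hw
  have hwK : ContinuousOn w K :=
    (hu.continuousOn.mono hS).add (continuousOn_const.mul
      (Real.continuous_exp.comp (continuous_const.mul (hcont.pow 2))).continuousOn)
  -- the maximum over the annulus
  have hKa : IsCompact (K ∩ {x | ρ ≤ ‖L (x - y)‖}) :=
    hKc.inter_right (isClosed_le continuous_const hcont)
  obtain ⟨x, ⟨hxS, hxρ⟩, hxmax⟩ := hKa.exists_isMaxOn ⟨x₀, hx₀.le, hρx₀.le⟩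
    (hwK.mono Set.inter_subset_left)
  have hwx : c + ε * Real.exp (-α * S ^ 2) < w x := by
    refine lt_of_lt_of_le ?_ (hxmax ⟨hx₀.le, hρx₀.le⟩)
    simp only [hw, hg, hux₀]
    gcongr 1
    apply mul_lt_mul_of_pos_left _ hε0
    apply Real.exp_lt_exp.2
    have : ‖L (x₀ - y)‖ ^ 2 < S ^ 2 := by gcongr
    nlinarith
  have hxS' : ‖L (x - y)‖ < S := by
    refine lt_of_le_of_ne hxS fun heq => ?_
    have h1 : w x = u x + ε * Real.exp (-α * S ^ 2) := by simp only [hw, hg, heq]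
    have := hc x (hS x hxS)
    linarith
  have hxρ' : ρ < ‖L (x - y)‖ := by
    refine lt_of_le_of_ne hxρ fun heq => ?_
    have h1 := hρ x heq.symm.le
    have h2 : g x ≤ 1 := Real.exp_le_one_iff.2 (by nlinarith [sq_nonneg ‖L (x - y)‖])
    have h3 : 0 < ε * Real.exp (-α * S ^ 2) := by positivity
    have h4 : ε * g x ≤ ε := by nlinarith
    have h5 : w x = u x + ε * g x := rfl
    rw [hε] at h4 h3 hwx h5
    linarith
  have hxU := hS x hxS
  have hlocmax : IsLocalMax w x := by
    have h1 : ∀ᶠ z in 𝓝 x, ‖L (z - y)‖ < S := hcont.continuousAt.eventually_lt_const hxS'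
    have h2 : ∀ᶠ z in 𝓝 x, ρ < ‖L (z - y)‖ := hcont.continuousAt.eventually_const_lt hxρ'
    filter_upwards [h1, h2] with z hz1 hz2 using hxmax ⟨hz1.le, hz2.le⟩
  have hux : ContDiffAt ℝ 2 u x := hu.contDiffAt (hU.mem_nhds hxU)
  have hd := derivs_at_max_add_gaussian (L : E →L[ℝ] F) hux hlocmax
  have hpde := fderiv_fderiv_add_of_comp_eq_neg hux (hv.contDiffAt (hU.mem_nhds hxU))
    ((hJ.contDiffAt (hU.mem_nhds hxU)).differentiableAt (by norm_num)) (hJ2 x hxU)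
    (Filter.mem_of_superset (hU.mem_nhds hxU) h) (x - y)
  have hNx : ‖L (x - y)‖ ^ 2 + ‖L (J x (x - y))‖ ^ 2 - inner ℝ (L (x - y)) (L (b x)) ≤ N :=
    hN (Set.mem_image_of_mem _ hxS)
  have d1 := (hd (x - y)).2
  have d2 := (hd (J x (x - y))).2
  have d3 := (hd (b x)).1
  rw [d3] at hpde
  simp only [ContinuousLinearEquiv.coe_coe, real_inner_self_eq_norm_sq] at d1 d2 hpde
  have hgx : 0 < Real.exp (-α * ‖L (x - y)‖ ^ 2) := Real.exp_pos _
  set e := Real.exp (-α * ‖L (x - y)‖ ^ 2)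
  set A := ‖L (x - y)‖ ^ 2 with hA
  set C := ‖L (J x (x - y))‖ ^ 2
  set B := inner ℝ (L (x - y)) (L (J x (x - y)))
  set D := inner ℝ (L (x - y)) (L (b x))
  have hA' : ρ ^ 4 ≤ A ^ 2 := by
    rw [hA, ← pow_mul]
    gcongr
  have hαA : |N| + 1 ≤ 2 * α * A ^ 2 := by
    have h1 : 2 * α * ρ ^ 4 = |N| + 1 := by rw [hα]; field_simp
    nlinarith
  have hsum : (2 * α * ε * e) * (D + 2 * α * A ^ 2 + 2 * α * B ^ 2 - A - C) ≤ 0 := by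
    nlinarith
  have hpos : 0 < D + 2 * α * A ^ 2 + 2 * α * B ^ 2 - A - C := by
    have := le_abs_self N
    have : 0 ≤ 2 * α * B ^ 2 := by positivity
    linarith
  have : 0 < (2 * α * ε * e) * (D + 2 * α * A ^ 2 + 2 * α * B ^ 2 - A - C) := by positivity
  linarith

end MaximumPrinciple

/-! ### Tensor powers and wedge products at a point -/

section LinearAlgebra

/-- A `1`-form `β` of type `(0,1)` is determined by its wedge product with a nonzero form `α` of
type `(k,0)`: comparing `β ∧ α` at `(w, v₁, …, v_k)` and at `(J w, v₁, …, v_k)` isolates the term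
`β w * α (v₁, …, v_k)`. -/
theorem eq_zero_of_oneFormWedge_eq_zero {V : Type*} [AddCommGroup V] [Module ℝ V]
    [TopologicalSpace V] {J : V →L[ℝ] V} {k : ℕ} {α : V [⋀^Fin k]→L[ℝ] ℂ}
    (hα : α ∈ holomorphicForms k J) (hα0 : α ≠ 0) {β : V → ℂ}
    (hβ : ∀ w, β (J w) = -(Complex.I * β w)) (h : ∀ v, oneFormWedge β α v = 0) (w : V) :
    β w = 0 := by
  obtain ⟨v, hv⟩ : ∃ v, α v ≠ 0 := by
    by_contra! hall
    exact hα0 (ContinuousAlternatingMap.ext hall)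
  have h1 : ∀ w, β w * α v +
      ∑ i : Fin k, (-1) ^ ((i : ℕ) + 1) * β (v i) *
        α (i.succ.removeNth (Fin.cons w v : Fin (k + 1) → V)) = 0 := by
    intro w
    have h2 := h (Fin.cons w v)
    rw [oneFormWedge, Fin.sum_univ_succ] at h2
    simpa [Fin.removeNth_zero] using h2
  have h2 : ∀ i : Fin k, α (i.succ.removeNth (Fin.cons (J w) v : Fin (k + 1) → V)) =
      Complex.I * α (i.succ.removeNth (Fin.cons w v : Fin (k + 1) → V)) := by
    intro i
    obtain ⟨n, rfl⟩ : ∃ n, k = n + 1 := ⟨k - 1, by have := i.2; omega⟩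
    have h3 := hα (i.succ.removeNth (Fin.cons w v : Fin (n + 2) → V)) 0
    have h4 : ∀ u : V, i.succ.removeNth (Fin.cons u v : Fin (n + 2) → V) =
        Fin.cons u (i.removeNth v) := by
      intro u
      ext j
      refine Fin.cases ?_ (fun j => ?_) j
      · simp [Fin.removeNth]
      · simp [Fin.removeNth, Fin.succ_succAbove_succ]
    rw [← h3, h4, h4]
    congr 1
    simp
  have e1 := h1 w
  have e2 := h1 (J w)
  simp only [h2, hβ] at e2
  have e3 : ∑ i : Fin k, (-1) ^ ((i : ℕ) + 1) * β (v i) *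
      (Complex.I * α (i.succ.removeNth (Fin.cons w v : Fin (k + 1) → V))) =
      Complex.I * ∑ i : Fin k, (-1) ^ ((i : ℕ) + 1) * β (v i) *
        α (i.succ.removeNth (Fin.cons w v : Fin (k + 1) → V)) := by
    rw [Finset.mul_sum]
    exact Finset.sum_congr rfl fun i _ => by ring
  rw [e3] at e2
  have e4 : 2 * (Complex.I * (β w * α v)) = 0 := by linear_combination Complex.I * e1 - e2
  simpa [hv] using e4

variable {K : Type*} [AddCommMonoid K] [Module ℂ K]

/-- A multiple of a pure power `a ⊗ ⋯ ⊗ a` determines its coefficient, as soon as some linear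
functional does not vanish at `a`. -/
theorem PiTensorProduct.smul_tprod_const_cancel {l : ℕ} {a : K} {φ : K →ₗ[ℂ] ℂ} (hφ : φ a ≠ 0)
    {c d : ℂ} (h : c • PiTensorProduct.tprod ℂ (fun _ : Fin l => a) =
      d • PiTensorProduct.tprod ℂ (fun _ : Fin l => a)) : c = d := by
  have h1 := congrArg (PiTensorProduct.lift
    ((MultilinearMap.mkPiAlgebra ℂ (Fin l) ℂ).compLinearMap fun _ => φ)) h
  simpa [hφ] using h1

/-- The `k`-th power map from the `l`-th to the `l * k`-th tensor power, on pure powers. -/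
theorem PiTensorProduct.exists_pow (l k : ℕ) {n : ℕ} (hn : n = l * k) :
    ∃ P : PiTensorProduct ℂ (fun _ : Fin l => K) → PiTensorProduct ℂ (fun _ : Fin n => K),
      ∀ (c : ℂ) (a : K), P (c • PiTensorProduct.tprod ℂ fun _ => a) =
        c ^ k • PiTensorProduct.tprod ℂ fun _ => a := by
  subst hn
  induction k with
  | zero =>
    refine ⟨fun _ => PiTensorProduct.tprod ℂ fun i => i.elim0, fun c a => ?_⟩
    rw [pow_zero, one_smul]
    exact congrArg _ (funext fun i => i.elim0)
  | succ k ih =>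
    obtain ⟨P, hP⟩ := ih
    refine ⟨fun x => TensorPower.mulEquiv (R := ℂ) (M := K) (n := l * k) (m := l)
      (TensorProduct.tmul ℂ (P x) x), fun c a => ?_⟩
    have h1 := TensorPower.tprod_mul_tprod ℂ (fun _ : Fin (l * k) => a) (fun _ : Fin l => a)
    rw [TensorPower.gMul_def] at h1
    have h2 : Fin.append (fun _ : Fin (l * k) => a) (fun _ : Fin l => a) = fun _ => a := by
      funext i
      refine Fin.addCases (fun i => ?_) (fun i => ?_) i <;> simp
    rw [h2] at h1
    beta_reduce
    rw [hP, TensorProduct.smul_tmul_smul, map_smul, h1, pow_succ]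
    rfl

theorem PiTensorProduct.subsingleton_of_subsingleton [Subsingleton K] {l : ℕ} (hl : 1 ≤ l)
    (x : PiTensorProduct ℂ (fun _ : Fin l => K)) : x = 0 := by
  induction x using PiTensorProduct.induction_on with
  | smul_tprod r f =>
    rw [(PiTensorProduct.tprod ℂ).map_coord_zero ⟨0, hl⟩ (Subsingleton.elim _ _), smul_zero]
  | add x y hx hy => rw [hx, hy, add_zero]

end LinearAlgebra

/-! ### Pseudoholomorphic functions on a compact almost complex manifold -/

section Charts

variable {E : Type*} [NormedAddCommGroup E] [NormedSpace ℝ E]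
  {M : Type*} [TopologicalSpace M] [ChartedSpace E M] [IsManifold 𝓘(ℝ, E) ∞ M]

theorem mfderiv_chartAt_self (p : M) :
    mfderiv 𝓘(ℝ, E) 𝓘(ℝ, E) (chartAt E p) p = ContinuousLinearMap.id ℝ E := by
  rw [mfderiv_chartAt_eq_tangentCoordChange (mem_chart_source E p)]
  ext v
  exact tangentCoordChange_self (I := 𝓘(ℝ, E)) (mem_extChartAt_source p)

theorem mfderiv_chartAt_mfderiv_symm (p : M) {y : E} (hy : y ∈ (chartAt E p).target) (w : E) :
    mfderiv 𝓘(ℝ, E) 𝓘(ℝ, E) (chartAt E p) ((chartAt E p).symm y)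
      (mfderiv 𝓘(ℝ, E) 𝓘(ℝ, E) (chartAt E p).symm y w) = w :=
  congrArg (fun L => L w) ((mdifferentiable_chart (I := 𝓘(ℝ, E)) p).comp_symm_deriv hy)

theorem mfderiv_symm_mfderiv_chartAt (p : M) {y : E} (hy : y ∈ (chartAt E p).target)
    (w : TangentSpace 𝓘(ℝ, E) ((chartAt E p).symm y)) :
    mfderiv 𝓘(ℝ, E) 𝓘(ℝ, E) (chartAt E p).symm y
      (mfderiv 𝓘(ℝ, E) 𝓘(ℝ, E) (chartAt E p) ((chartAt E p).symm y) w) = w := by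
  have h := (mdifferentiable_chart (I := 𝓘(ℝ, E)) p).symm_comp_deriv ((chartAt E p).map_target hy)
  rw [(chartAt E p).right_inv hy] at h
  exact congrArg (fun L => L w) h

namespace AlmostComplexStructure

/-- The expression of an almost complex structure in the chart around `p`. It is meaningful on the
target of the chart. -/
noncomputable def inChart (J : AlmostComplexStructure E M) (p : M) (y : E) : E →L[ℝ] E :=
  (mfderiv 𝓘(ℝ, E) 𝓘(ℝ, E) (chartAt E p) ((chartAt E p).symm y)).comp
    ((J.toFun ((chartAt E p).symm y)).comp (mfderiv 𝓘(ℝ, E) 𝓘(ℝ, E) (chartAt E p).symm y))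

theorem mfderiv_symm_inChart (J : AlmostComplexStructure E M) (p : M) {y : E}
    (hy : y ∈ (chartAt E p).target) (w : E) :
    mfderiv 𝓘(ℝ, E) 𝓘(ℝ, E) (chartAt E p).symm y (J.inChart p y w) =
      J.toFun ((chartAt E p).symm y) (mfderiv 𝓘(ℝ, E) 𝓘(ℝ, E) (chartAt E p).symm y w) :=
  mfderiv_symm_mfderiv_chartAt p hy _

theorem inChart_inChart (J : AlmostComplexStructure E M) (p : M) {y : E}
    (hy : y ∈ (chartAt E p).target) (w : E) : J.inChart p y (J.inChart p y w) = -w := by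
  have h := J.mfderiv_symm_inChart p hy w
  change mfderiv 𝓘(ℝ, E) 𝓘(ℝ, E) (chartAt E p) ((chartAt E p).symm y)
    (J.toFun ((chartAt E p).symm y)
      (mfderiv 𝓘(ℝ, E) 𝓘(ℝ, E) (chartAt E p).symm y (J.inChart p y w))) = -w
  rw [h, J.sq_eq_neg, map_neg, mfderiv_chartAt_mfderiv_symm p hy]
  rfl

theorem contDiffOn_inChart [FiniteDimensional ℝ E] (J : AlmostComplexStructure E M) (p : M) :
    ContDiffOn ℝ ∞ (J.inChart p) (chartAt E p).target := by
  rw [contDiffOn_clm_apply]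
  intro w
  rw [← contMDiffOn_vectorSpace_iff_contDiffOn (V := fun y => (J.inChart p y w : E))]
  set φ := chartAt E p
  have h1 : ContMDiffOn 𝓘(ℝ, E) 𝓘(ℝ, E).tangent ∞
      (fun y : E => (⟨y, w⟩ : TangentBundle 𝓘(ℝ, E) E)) φ.target :=
    contMDiffOn_vectorSpace_iff_contDiffOn.2 contDiffOn_const
  have h2 : ContMDiffOn 𝓘(ℝ, E).tangent 𝓘(ℝ, E).tangent ∞
      (tangentMapWithin 𝓘(ℝ, E) 𝓘(ℝ, E) φ.symm φ.target) _ :=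
    (contMDiffOn_chart_symm (I := 𝓘(ℝ, E)) (n := ∞) (x := p)).contMDiffOn_tangentMapWithin
      (by simp) φ.open_target.uniqueMDiffOn
  have h3 : ContMDiffOn 𝓘(ℝ, E).tangent 𝓘(ℝ, E).tangent ∞
      (tangentMapWithin 𝓘(ℝ, E) 𝓘(ℝ, E) φ φ.source) _ :=
    (contMDiffOn_chart (I := 𝓘(ℝ, E)) (n := ∞) (x := p)).contMDiffOn_tangentMapWithin
      (by simp) φ.open_source.uniqueMDiffOn
  have h4 := h3.comp ((J.smooth.comp_contMDiffOn (h2.comp h1 fun y hy => hy)))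
    (fun y hy => φ.map_target hy)
  refine h4.congr fun y hy => ?_
  simp only [Function.comp, tangentMapWithin]
  rw [mfderivWithin_of_isOpen φ.open_target hy,
    mfderivWithin_of_isOpen φ.open_source (φ.map_target hy), φ.right_inv hy]
  rfl

theorem delbarFun_apply_toFun (J : AlmostComplexStructure E M) (f : M → ℂ) (x : M)
    (v : TangentSpace 𝓘(ℝ, E) x) :
    J.delbarFun f x (J.toFun x v) = -(Complex.I * J.delbarFun f x v) := by
  simp only [delbarFun, J.sq_eq_neg, map_neg]
  linear_combination ((1 / 2) * differential f x (J.toFun x v)) * Complex.I_mul_I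

theorem differential_toFun_of_delbarFun_eq_zero (J : AlmostComplexStructure E M) {f : M → ℂ}
    {x : M} (h : ∀ v, J.delbarFun f x v = 0) (v : TangentSpace 𝓘(ℝ, E) x) :
    differential f x (J.toFun x v) = Complex.I * differential f x v := by
  have h1 := h v
  simp only [delbarFun] at h1
  linear_combination (-2 * Complex.I) * h1 + differential f x (J.toFun x v) * Complex.I_mul_I

/-- The real part of a pseudoholomorphic function that attains its maximum at `p` is constant near
`p`. -/
theorem eventually_re_eq_of_delbarFun_eq_zero [FiniteDimensional ℝ E]
    (J : AlmostComplexStructure E M) {f : M → ℂ} (hf : ContMDiff 𝓘(ℝ, E) 𝓘(ℝ, ℂ) ∞ f)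
    (h : ∀ x v, J.delbarFun f x v = 0) {c : ℝ} (hc : ∀ x, (f x).re ≤ c) {p : M}
    (hp : (f p).re = c) : ∀ᶠ x in 𝓝 p, (f x).re = c := by
  set φ := chartAt E p with hφ
  set F : E → ℂ := fun y => f (φ.symm y) with hF
  have hFs : ContDiffOn ℝ ∞ F φ.target :=
    (hf.comp_contMDiffOn (contMDiffOn_chart_symm (I := 𝓘(ℝ, E)) (n := ∞) (x := p))).contDiffOn
  have hFd : ∀ y ∈ φ.target, DifferentiableAt ℝ F y := fun y hy =>
    (hFs.contDiffAt (φ.open_target.mem_nhds hy)).differentiableAt (by simp)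
  have hFJ : ∀ y ∈ φ.target, ∀ w, fderiv ℝ F y (J.inChart p y w) =
      Complex.I * fderiv ℝ F y w := by
    intro y hy w
    have h1 : ∀ w, fderiv ℝ F y w =
        differential f (φ.symm y) (mfderiv 𝓘(ℝ, E) 𝓘(ℝ, E) φ.symm y w) := by
      intro w
      rw [← mfderiv_eq_fderiv]
      have h2 := mfderiv_comp y (I' := 𝓘(ℝ, E))
        (hf.contMDiffAt (x := φ.symm y) |>.mdifferentiableAt (by simp))
        ((mdifferentiable_chart (I := 𝓘(ℝ, E)) p).mdifferentiableAt_symm hy)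
      exact congrArg (fun L => L w) h2
    rw [h1, h1, J.mfderiv_symm_inChart p hy]
    exact J.differential_toFun_of_delbarFun_eq_zero (h _) _
  have hre : ∀ y ∈ φ.target, ∀ w, fderiv ℝ (fun y => (F y).re) y w = (fderiv ℝ F y w).re := by
    intro y hy w
    exact congrArg (fun L => L w)
      ((Complex.reCLM.hasFDerivAt.comp y (hFd y hy).hasFDerivAt).fderiv)
  have him : ∀ y ∈ φ.target, ∀ w, fderiv ℝ (fun y => (F y).im) y w = (fderiv ℝ F y w).im := by
    intro y hy w
    exact congrArg (fun L => L w)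
      ((Complex.imCLM.hasFDerivAt.comp y (hFd y hy).hasFDerivAt).fderiv)
  have h2 : (2 : ℕ∞ω) ≤ ∞ := WithTop.coe_le_coe.2 (le_top : (2 : ℕ∞) ≤ ⊤)
  have h1 : (1 : ℕ∞ω) ≤ ∞ := by exact_mod_cast le_top
  set L := toEuclidean (E := E)
  have hpt : φ p ∈ φ.target := mem_chart_target E p
  obtain ⟨S, hS0, hS⟩ : ∃ S > 0, ∀ y, ‖L (y - φ p)‖ < 2 * S → y ∈ φ.target := by
    have hlim : Filter.Tendsto (fun z => φ p + L.symm z) (𝓝 0) (𝓝 (φ p)) := by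
      have : Continuous fun z => φ p + L.symm z := continuous_const.add L.symm.continuous
      simpa using this.tendsto 0
    obtain ⟨r, hr, hr'⟩ :=
      Metric.eventually_nhds_iff.1 (hlim.eventually (φ.open_target.mem_nhds hpt))
    refine ⟨r / 2, half_pos hr, fun y hy => ?_⟩
    have := @hr' (L (y - φ p)) (by rw [dist_zero_right]; linarith)
    have hy' : φ p + L.symm (L (y - φ p)) = y := by simp
    rwa [hy'] at this
  have hnear : ∀ y, ‖L (y - φ p)‖ < S → (F y).re = c := by
    intro y hy
    refine eq_of_le_of_comp_eq_neg L φ.open_target (u := fun y => (F y).re)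
      (v := fun y => (F y).im) (J := J.inChart p)
      ((Complex.reCLM.contDiff.comp_contDiffOn hFs).of_le h2)
      ((Complex.imCLM.contDiff.comp_contDiffOn hFs).of_le h2)
      ((J.contDiffOn_inChart p).of_le h1) (fun x hx => J.inChart_inChart p hx)
      (fun x hx w => ?_) (fun x _ => hc _) (x₀ := φ p) (S := S) (fun x hx => ?_) ?_ ?_
    · rw [hre x hx, him x hx, hFJ x hx]
      simp
    · refine hS x ?_
      have : L (x - φ p) = L (x - y) + L (y - φ p) := by rw [← map_add]; congr 1; abel
      rw [this]
      linarith [norm_add_le (L (x - y)) (L (y - φ p))]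
    · rw [← norm_neg, ← map_neg, neg_sub]
      exact hy
    · simp only [hF, φ.left_inv (mem_chart_source E p), hp]
  have hcont : ContinuousAt (fun x => ‖L (φ x - φ p)‖) p :=
    (L.continuous.continuousAt.comp
      ((φ.continuousAt (mem_chart_source E p)).sub continuousAt_const)).norm
  have h0 : ∀ᶠ x in 𝓝 p, ‖L (φ x - φ p)‖ < S :=
    hcont.eventually_lt_const (by simpa using hS0)
  filter_upwards [h0, φ.open_source.mem_nhds (mem_chart_source E p)] with x hx hxs
  have := hnear (φ x) hx
  simpa only [hF, φ.left_inv hxs] using this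

theorem re_eq_of_delbarFun_eq_zero [FiniteDimensional ℝ E] [CompactSpace M] [ConnectedSpace M]
    (J : AlmostComplexStructure E M) {f : M → ℂ} (hf : ContMDiff 𝓘(ℝ, E) 𝓘(ℝ, ℂ) ∞ f)
    (h : ∀ x v, J.delbarFun f x v = 0) : ∃ c : ℝ, ∀ x, (f x).re = c := by
  have hcont : Continuous fun x => (f x).re := Complex.continuous_re.comp hf.continuous
  obtain ⟨p, -, hp⟩ := isCompact_univ.exists_isMaxOn Set.univ_nonempty hcont.continuousOn
  refine ⟨(f p).re, fun x => ?_⟩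
  have hclopen : IsClopen {x | (f x).re = (f p).re} := by
    refine ⟨isClosed_eq hcont continuous_const, isOpen_iff_mem_nhds.2 fun q hq => ?_⟩
    exact J.eventually_re_eq_of_delbarFun_eq_zero hf h (fun x => hp (Set.mem_univ x)) hq
  have := hclopen.eq_univ ⟨p, rfl⟩
  exact Set.eq_univ_iff_forall.1 this x

theorem delbarFun_const_mul (J : AlmostComplexStructure E M) {f : M → ℂ} {x : M}
    (hf : MDifferentiableAt 𝓘(ℝ, E) 𝓘(ℝ, ℂ) f x) (c : ℂ) (v : TangentSpace 𝓘(ℝ, E) x) :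
    J.delbarFun (fun x => c * f x) x v = c * J.delbarFun f x v := by
  have h2 : HasMFDerivAt 𝓘(ℝ, ℂ) 𝓘(ℝ, ℂ) (fun z : ℂ => c * z) (f x)
      (ContinuousLinearMap.mul ℝ ℂ c) :=
    ((ContinuousLinearMap.mul ℝ ℂ c).hasFDerivAt).hasMFDerivAt
  have h := (h2.comp x hf.hasMFDerivAt).mfderiv
  have h1 : ∀ u : TangentSpace 𝓘(ℝ, E) x,
      differential (fun x => c * f x) x u = c * differential f x u :=
    fun u => congrArg (fun L => L u) h
  simp only [delbarFun, h1]
  ring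

/-- On a compact connected almost complex manifold every pseudoholomorphic function is constant. -/
theorem eq_const_of_delbarFun_eq_zero [FiniteDimensional ℝ E] [CompactSpace M] [ConnectedSpace M]
    (J : AlmostComplexStructure E M) {f : M → ℂ} (hf : ContMDiff 𝓘(ℝ, E) 𝓘(ℝ, ℂ) ∞ f)
    (h : ∀ x v, J.delbarFun f x v = 0) : ∃ c : ℂ, ∀ x, f x = c := by
  obtain ⟨a, ha⟩ := J.re_eq_of_delbarFun_eq_zero hf h
  -- the imaginary part of `f` is the real part of `-i f`
  obtain ⟨b, hb⟩ := J.re_eq_of_delbarFun_eq_zero (f := fun x => -Complex.I * f x)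
    ((contDiff_const.mul contDiff_id).contMDiff.comp hf) fun x v => by
      rw [J.delbarFun_const_mul (hf.contMDiffAt.mdifferentiableAt (by simp)), h, mul_zero]
  refine ⟨⟨a, b⟩, fun x => Complex.ext (ha x) ?_⟩
  simpa using hb x

end AlmostComplexStructure

end Charts

/-! ### Local frames of the canonical bundle -/

section Frames

variable {E : Type*} [NormedAddCommGroup E] [NormedSpace ℝ E]

/-- The pullback of a fixed form depends smoothly on the linear map. Mathlib has this for
multilinear maps; in finite dimension the inclusion of the alternating maps has a continuous left
inverse. -/
theorem ContinuousAlternatingMap.contDiff_compContinuousLinearMap [FiniteDimensional ℝ E] {k : ℕ}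
    {n : ℕ∞ω} (α : E [⋀^Fin k]→L[ℝ] ℂ) :
    ContDiff ℝ n fun g : E →L[ℝ] E => α.compContinuousLinearMap g := by
  have hfin : FiniteDimensional ℝ (ContinuousMultilinearMap ℝ (fun _ : Fin k => E) ℂ) :=
    FiniteDimensional.of_injective (V₂ := MultilinearMap ℝ (fun _ : Fin k => E) ℂ)
      { toFun := fun f => f.toMultilinearMap
        map_add' := fun _ _ => rfl
        map_smul' := fun _ _ => rfl }
      ContinuousMultilinearMap.toMultilinearMap_injective
  let ι : (E [⋀^Fin k]→L[ℝ] ℂ) →ₗ[ℝ] ContinuousMultilinearMap ℝ (fun _ : Fin k => E) ℂ :=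
    { toFun := fun f => f.toContinuousMultilinearMap
      map_add' := fun _ _ => rfl
      map_smul' := fun _ _ => rfl }
  obtain ⟨r, hr⟩ := ι.exists_leftInverse_of_injective (LinearMap.ker_eq_bot.2
    ContinuousAlternatingMap.toContinuousMultilinearMap_injective)
  have h1 : ContDiff ℝ n fun g : E →L[ℝ] E => α.1.compContinuousLinearMap fun _ => g :=
    (((ContinuousMultilinearMap.compContinuousLinearMapContinuousMultilinear ℝ
      (fun _ : Fin k => E) (fun _ : Fin k => E) ℂ).contDiff).comp
        (contDiff_pi.2 fun _ => contDiff_id)).clm_apply contDiff_const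
  have h2 : (fun g : E →L[ℝ] E => α.compContinuousLinearMap g) =
      r.toContinuousLinearMap ∘ fun g => α.1.compContinuousLinearMap fun _ => g :=
    funext fun g => (LinearMap.congr_fun hr (α.compContinuousLinearMap g)).symm
  rw [h2]
  exact r.toContinuousLinearMap.contDiff.comp h1

variable {M : Type*} [TopologicalSpace M] [ChartedSpace E M] [IsManifold 𝓘(ℝ, E) ∞ M]

namespace AlmostComplexStructure

/-- The derivative at `x` of the chart around `p`, with values in `T_p M = E`. -/
noncomputable def chartDeriv (p x : M) : TangentSpace 𝓘(ℝ, E) x →L[ℝ] TangentSpace 𝓘(ℝ, E) p :=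
  mfderiv 𝓘(ℝ, E) 𝓘(ℝ, E) (chartAt E p) x

theorem chartDeriv_self (p : M) (v : TangentSpace 𝓘(ℝ, E) p) : chartDeriv p p v = v :=
  congrArg (fun L => L v) (mfderiv_chartAt_self p)

/-- The linear map `(A - J_p A J_x) / 2` from `T_x M` to `T_p M`, where `A` is the derivative at `x`
of the chart around `p`. It is complex linear, and the identity for `x = p`. -/
noncomputable def transport (J : AlmostComplexStructure E M) (p x : M) :
    TangentSpace 𝓘(ℝ, E) x →L[ℝ] TangentSpace 𝓘(ℝ, E) p :=
  (1 / 2 : ℝ) • (chartDeriv p x - (J.toFun p).comp ((chartDeriv p x).comp (J.toFun x)))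

theorem transport_apply (J : AlmostComplexStructure E M) (p x : M)
    (v : TangentSpace 𝓘(ℝ, E) x) : J.transport p x v =
      (1 / 2 : ℝ) • (chartDeriv p x v - J.toFun p (chartDeriv p x (J.toFun x v))) :=
  rfl

theorem transport_toFun (J : AlmostComplexStructure E M) (p x : M)
    (v : TangentSpace 𝓘(ℝ, E) x) :
    J.transport p x (J.toFun x v) = J.toFun p (J.transport p x v) := by
  rw [transport_apply, transport_apply, J.sq_eq_neg, map_smul, map_sub, J.sq_eq_neg, map_neg,
    map_neg]
  congr 1
  abel

theorem transport_self (J : AlmostComplexStructure E M) (p : M) (v : TangentSpace 𝓘(ℝ, E) p) :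
    J.transport p p v = v := by
  rw [transport_apply, chartDeriv_self, chartDeriv_self, J.sq_eq_neg]
  module

/-- The extension of an `(m,0)`-form at `p` by the complex linear maps `transport`. -/
noncomputable def extendForm {m : ℕ} (J : AlmostComplexStructure E M) {p : M} (α : J.CanonicalFiber m p)
    (x : M) : J.CanonicalFiber m x :=
  ⟨α.1.compContinuousLinearMap (J.transport p x), fun v j => by
    have h : (J.transport p x) ∘ Function.update v j (J.toFun x (v j)) =
        Function.update ((J.transport p x) ∘ v) j (J.toFun p (((J.transport p x) ∘ v) j)) := by
      rw [Function.comp_update, Function.comp_apply, transport_toFun]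
    rw [ContinuousAlternatingMap.compContinuousLinearMap_apply, h]
    exact α.2 _ j⟩

theorem extendForm_self {m : ℕ} (J : AlmostComplexStructure E M) {p : M}
    (α : J.CanonicalFiber m p) : J.extendForm α p = α := by
  apply Subtype.ext
  apply ContinuousAlternatingMap.ext
  intro v
  exact congrArg α.1 (funext fun i => J.transport_self p (v i))

theorem isSmoothFormOn_extendForm [FiniteDimensional ℝ E] {m : ℕ} (J : AlmostComplexStructure E M) {p : M}
    (α : J.CanonicalFiber m p) :
    IsSmoothFormOn (fun x => (J.extendForm α x).1) (chartAt E p).source := by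
  intro x₀
  set φ := chartAt E p
  set ψ := chartAt E x₀
  set W := ψ.target ∩ ψ.symm ⁻¹' φ.source with hW
  have hWo : IsOpen W := ψ.isOpen_inter_preimage_symm φ.open_source
  let J₀ : E →L[ℝ] E := J.toFun p
  -- in the chart `ψ` around `x₀`, the derivative of `φ` becomes that of the transition map
  have hD : ContDiffOn ℝ ∞ (fderiv ℝ (φ ∘ ψ.symm)) W := by
    have h1 : ContDiffOn ℝ ∞ (φ ∘ ψ.symm) W := by
      have h2 := (contMDiffOn_chart (I := 𝓘(ℝ, E)) (n := ∞) (x := p)).comp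
        ((contMDiffOn_chart_symm (I := 𝓘(ℝ, E)) (n := ∞) (x := x₀)).mono
          Set.inter_subset_left) (fun y (hy : y ∈ W) => hy.2)
      exact h2.contDiffOn
    exact h1.fderiv_of_isOpen hWo (by simp)
  have hJ : ContDiffOn ℝ ∞ (J.inChart x₀) W :=
    (J.contDiffOn_inChart x₀).mono Set.inter_subset_left
  have hT : ContDiffOn ℝ ∞ (fun y => (1 / 2 : ℝ) • (fderiv ℝ (φ ∘ ψ.symm) y -
      J₀.comp ((fderiv ℝ (φ ∘ ψ.symm) y).comp (J.inChart x₀ y)))) W :=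
    (hD.sub (contDiffOn_const.clm_comp (hD.clm_comp hJ))).const_smul (1 / 2 : ℝ)
  let α₀ : E [⋀^Fin m]→L[ℝ] ℂ := α.1
  refine ((α₀.contDiff_compContinuousLinearMap (n := ∞)).comp_contDiffOn hT).congr fun y hy => ?_
  have hA : ∀ w : E, fderiv ℝ (φ ∘ ψ.symm) y w =
      mfderiv 𝓘(ℝ, E) 𝓘(ℝ, E) φ (ψ.symm y) (mfderiv 𝓘(ℝ, E) 𝓘(ℝ, E) ψ.symm y w) := by
    intro w
    rw [← mfderiv_eq_fderiv]
    exact congrArg (fun L => L w) (mfderiv_comp y (I' := 𝓘(ℝ, E))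
      ((mdifferentiable_chart (I := 𝓘(ℝ, E)) p).mdifferentiableAt hy.2)
      ((mdifferentiable_chart (I := 𝓘(ℝ, E)) x₀).mdifferentiableAt_symm hy.1))
  apply ContinuousAlternatingMap.ext
  intro v
  refine congrArg α.1 (funext fun i => ?_)
  let A : E →L[ℝ] E := mfderiv 𝓘(ℝ, E) 𝓘(ℝ, E) φ (ψ.symm y)
  let B : E →L[ℝ] E := mfderiv 𝓘(ℝ, E) 𝓘(ℝ, E) ψ.symm y
  let J₁ : E →L[ℝ] E := J.toFun (ψ.symm y)
  change (1 / 2 : ℝ) • (A (B (v i)) - J₀ (A (J₁ (B (v i))))) =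
    (1 / 2 : ℝ) • (fderiv ℝ (φ ∘ ψ.symm) y (v i) -
      J₀ (fderiv ℝ (φ ∘ ψ.symm) y (J.inChart x₀ y (v i))))
  rw [hA, hA, J.mfderiv_symm_inChart x₀ hy.1]
  rfl

/-- Wherever the canonical bundle has a nonzero fibre, it has a local frame. -/
theorem exists_isLocalFrame [FiniteDimensional ℝ E] {m : ℕ} (J : AlmostComplexStructure E M) {p : M}
    {α : J.CanonicalFiber m p} (hα : α ≠ 0) :
    ∃ (U : Set M) (Ω : Π x : M, J.CanonicalFiber m x), p ∈ U ∧ J.IsLocalFrame U Ω := by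
  set φ := chartAt E p
  have hpt : φ p ∈ φ.target := mem_chart_target E p
  have hsm := J.isSmoothFormOn_extendForm α
  have hc : ContinuousOn (formInChart (fun x => (J.extendForm α x).1) p) φ.target := by
    refine (hsm p).continuousOn.mono fun y hy => ⟨hy, φ.map_target hy⟩
  set V := φ.target ∩ formInChart (fun x => (J.extendForm α x).1) p ⁻¹' {0}ᶜ with hV
  have hVo : IsOpen V := hc.isOpen_inter_preimage φ.open_target isOpen_compl_singleton
  refine ⟨φ.source ∩ φ ⁻¹' V, J.extendForm α, ⟨mem_chart_source E p, hpt, fun h0 => hα ?_⟩,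
    φ.isOpen_inter_preimage hVo, fun x₀ => (hsm x₀).mono ?_, fun x hx h0 => hx.2.2 ?_⟩
  · apply Subtype.ext
    apply ContinuousAlternatingMap.ext
    intro v
    have hφp : φ.symm (φ p) = p := φ.left_inv (mem_chart_source E p)
    have hB : ∀ w : E, (mfderiv 𝓘(ℝ, E) 𝓘(ℝ, E) φ.symm (φ p) w : E) = w := by
      intro w
      have h1 := mfderiv_chartAt_mfderiv_symm p hpt w
      rw [hφp] at h1
      have h2 := congrArg (fun L : E →L[ℝ] E =>
        L (mfderiv 𝓘(ℝ, E) 𝓘(ℝ, E) φ.symm (φ p) w)) (mfderiv_chartAt_self p)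
      exact h2.symm.trans h1
    have h3 : ∀ q, q = p → ((J.extendForm α q).1 : E [⋀^Fin m]→L[ℝ] ℂ) = α.1 := by
      rintro q rfl
      exact congrArg Subtype.val (J.extendForm_self α)
    have h4 := congrArg (fun β : E [⋀^Fin m]→L[ℝ] ℂ => β v) h0
    have h5 : ((J.extendForm α (φ.symm (φ p))).1 : E [⋀^Fin m]→L[ℝ] ℂ)
        (fun i => (mfderiv 𝓘(ℝ, E) 𝓘(ℝ, E) φ.symm (φ p) (v i) : E)) = 0 := h4
    calc α.1 v = ((J.extendForm α (φ.symm (φ p))).1 : E [⋀^Fin m]→L[ℝ] ℂ) v :=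
          (congrArg (fun β : E [⋀^Fin m]→L[ℝ] ℂ => β v) (h3 _ hφp)).symm
      _ = ((J.extendForm α (φ.symm (φ p))).1 : E [⋀^Fin m]→L[ℝ] ℂ)
          (fun i => (mfderiv 𝓘(ℝ, E) 𝓘(ℝ, E) φ.symm (φ p) (v i) : E)) :=
        congrArg _ (funext fun i => (hB (v i)).symm)
      _ = 0 := h5
  · exact fun y hy => ⟨hy.1, hy.2.1⟩
  · have h1 : φ.symm (φ x) = x := φ.left_inv hx.1
    change ((J.extendForm α (φ.symm (φ x))).1).compContinuousLinearMap _ = 0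
    have h2 : ∀ q, q = x → (J.extendForm α q).1 = 0 := by
      rintro q rfl
      exact congrArg Subtype.val h0
    rw [h2 _ h1]
    rfl

end AlmostComplexStructure

end Frames

/-! ### Powers and quotients of pseudoholomorphic sections -/

section Sections

variable {E : Type*} [NormedAddCommGroup E] [NormedSpace ℝ E]
  {M : Type*} [TopologicalSpace M] [ChartedSpace E M] [IsManifold 𝓘(ℝ, E) ∞ M]

namespace AlmostComplexStructure

theorem delbarFun_congr (J : AlmostComplexStructure E M) {f g : M → ℂ} {x : M}
    (h : f =ᶠ[𝓝 x] g) (v : TangentSpace 𝓘(ℝ, E) x) : J.delbarFun f x v = J.delbarFun g x v := by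
  have h0 : f x = g x := h.self_of_nhds
  have h1 : ∀ u : TangentSpace 𝓘(ℝ, E) x, differential f x u = differential g x u :=
    fun u => congrArg (fun L : TangentSpace 𝓘(ℝ, E) x →L[ℝ] ℂ => L u) (h.mfderiv_eq)
  simp only [delbarFun, h1]

theorem delbarFun_mul (J : AlmostComplexStructure E M) {f g : M → ℂ} {x : M}
    (hf : MDifferentiableAt 𝓘(ℝ, E) 𝓘(ℝ, ℂ) f x) (hg : MDifferentiableAt 𝓘(ℝ, E) 𝓘(ℝ, ℂ) g x)
    (v : TangentSpace 𝓘(ℝ, E) x) :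
    J.delbarFun (fun x => f x * g x) x v = f x * J.delbarFun g x v + g x * J.delbarFun f x v := by
  have h := (hf.hasMFDerivAt.mul hg.hasMFDerivAt).mfderiv
  have h1 : ∀ u : TangentSpace 𝓘(ℝ, E) x,
      differential (fun x => f x * g x) x u = f x * differential g x u + g x * differential f x u :=
    fun u => congrArg (fun L => L u) h
  simp only [delbarFun, h1]
  ring

theorem delbarFun_pow (J : AlmostComplexStructure E M) {f : M → ℂ} {x : M}
    (hf : MDifferentiableAt 𝓘(ℝ, E) 𝓘(ℝ, ℂ) f x) (k : ℕ) (v : TangentSpace 𝓘(ℝ, E) x) :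
    J.delbarFun (fun x => f x ^ (k + 1)) x v = (k + 1) * f x ^ k * J.delbarFun f x v := by
  induction k with
  | zero => simp
  | succ k ih =>
    have hk : MDifferentiableAt 𝓘(ℝ, E) 𝓘(ℝ, ℂ) (fun x => f x ^ (k + 1)) x :=
      (contDiff_id.pow (k + 1) |>.contMDiff (n := 1) (x := f x)).mdifferentiableAt
        (by norm_num) |>.comp x hf
    have h : (fun x => f x ^ (k + 1 + 1)) = fun x => f x ^ (k + 1) * f x := by
      funext x
      rw [pow_succ]
    rw [h, J.delbarFun_mul hk hf, ih]
    push_cast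
    ring

/-- A pseudoholomorphic section `σ` has a `k`-th power, given by `f ^ k Ω ^ (l k)` wherever
`σ = f Ω ^ l`. -/
theorem exists_pow_mem {m : ℕ} (J : AlmostComplexStructure E M) {l k n : ℕ} (hn : n = l * k)
    (hk : k ≠ 0) {σ : Π x : M, J.PluricanonicalFiber m l x}
    (hσ : σ ∈ J.pseudoholomorphicSections m l) :
    ∃ ρ ∈ J.pseudoholomorphicSections m n, ∀ (x : M) (c : ℂ) (a : J.CanonicalFiber m x),
      σ x = c • PiTensorProduct.tprod ℂ (fun _ : Fin l => a) →
        ρ x = c ^ k • PiTensorProduct.tprod ℂ (fun _ : Fin n => a) := by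
  choose P hP using fun x : M => PiTensorProduct.exists_pow (K := J.CanonicalFiber m x) l k hn
  refine ⟨fun x => P x (σ x), fun U Ω hΩ => ?_, fun x c a h => (congrArg (P x) h).trans (hP x c a)⟩
  obtain ⟨f, hf, hfσ, hf0⟩ := hσ U Ω hΩ
  refine ⟨fun x => f x ^ k, ?_, fun x hx => (congrArg (P x) (hfσ x hx)).trans (hP x _ _), fun x hx v => ?_⟩
  · exact (contDiff_id.pow k).contMDiff.comp_contMDiffOn hf
  · obtain ⟨k, rfl⟩ := Nat.exists_eq_succ_of_ne_zero hk
    have hfx : MDifferentiableAt 𝓘(ℝ, E) 𝓘(ℝ, ℂ) f x :=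
      (hf.contMDiffAt (hΩ.isOpen.mem_nhds hx)).mdifferentiableAt (by simp)
    have hw : oneFormWedge (J.delbarFun (fun x => f x ^ (k + 1)) x) (Ω x).1 v =
        (k + 1) * f x ^ k * oneFormWedge (J.delbarFun f x) (Ω x).1 v := by
      simp only [oneFormWedge, J.delbarFun_pow hfx, Finset.mul_sum]
      exact Finset.sum_congr rfl fun i _ => by ring
    rw [Nat.succ_eq_add_one, hw, hn]
    push_cast
    linear_combination ((k + 1) * f x ^ k) * hf0 x hx v

theorem CanonicalFiber.smul_tprod_cancel {m : ℕ} {J : AlmostComplexStructure E M} {x : M} {l : ℕ}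
    {a : J.CanonicalFiber m x} (ha : a ≠ 0) {c d : ℂ}
    (h : c • PiTensorProduct.tprod ℂ (fun _ : Fin l => a) =
      d • PiTensorProduct.tprod ℂ (fun _ : Fin l => a)) : c = d := by
  obtain ⟨v, hv⟩ : ∃ v, a.1 v ≠ 0 := by
    by_contra! hall
    exact ha (Subtype.ext (ContinuousAlternatingMap.ext hall))
  let φ : J.CanonicalFiber m x →ₗ[ℂ] ℂ :=
    { toFun := fun b => b.1 v
      map_add' := fun _ _ => rfl
      map_smul' := fun _ _ => rfl }
  exact PiTensorProduct.smul_tprod_const_cancel (φ := φ) hv h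

theorem CanonicalFiber.smul_tprod_ne_zero {m : ℕ} {J : AlmostComplexStructure E M} {x : M} {l : ℕ}
    {a : J.CanonicalFiber m x} (ha : a ≠ 0) {c : ℂ} (hc : c ≠ 0) :
    c • PiTensorProduct.tprod ℂ (fun _ : Fin l => a) ≠ 0 :=
  fun h => hc (CanonicalFiber.smul_tprod_cancel ha (h.trans (zero_smul ℂ _).symm))

/-- A nonvanishing value of a pluricanonical section forces a local frame to exist. -/
theorem exists_isLocalFrame_of_ne_zero [FiniteDimensional ℝ E] {m : ℕ}
    (J : AlmostComplexStructure E M) {l : ℕ} (hl : 1 ≤ l) {p : M}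
    {s : J.PluricanonicalFiber m l p} (hs : s ≠ 0) :
    ∃ (U : Set M) (Ω : Π x : M, J.CanonicalFiber m x), p ∈ U ∧ J.IsLocalFrame U Ω := by
  obtain ⟨α, hα⟩ : ∃ α : J.CanonicalFiber m p, α ≠ 0 := by
    by_contra! h
    have : Subsingleton (J.CanonicalFiber m p) := ⟨fun a b => (h a).trans (h b).symm⟩
    exact hs (PiTensorProduct.subsingleton_of_subsingleton hl s)
  exact J.exists_isLocalFrame hα

/-- The quotient of two pseudoholomorphic sections is a pseudoholomorphic function, hence
constant. -/
theorem exists_eq_smul_of_ne_zero [FiniteDimensional ℝ E] [CompactSpace M] [ConnectedSpace M]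
    {m : ℕ} (J : AlmostComplexStructure E M) {l : ℕ} (hl : 1 ≤ l)
    {σ τ : Π x : M, J.PluricanonicalFiber m l x} (hσ : σ ∈ J.pseudoholomorphicSections m l)
    (hτ : τ ∈ J.pseudoholomorphicSections m l) (hσ0 : ∀ x, σ x ≠ 0) : ∃ c : ℂ, τ = c • σ := by
  have hquot : ∀ x, ∃ c : ℂ, τ x = c • σ x := by
    intro x
    obtain ⟨U, Ω, hx, hΩ⟩ := J.exists_isLocalFrame_of_ne_zero hl (hσ0 x)
    obtain ⟨g, -, hgσ, -⟩ := hσ U Ω hΩ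
    obtain ⟨h, -, hhτ, -⟩ := hτ U Ω hΩ
    have hg0 : g x ≠ 0 := fun h0 => hσ0 x (by rw [hgσ x hx, h0, zero_smul])
    refine ⟨h x / g x, ?_⟩
    rw [hgσ x hx, hhτ x hx, smul_smul, div_mul_cancel₀ _ hg0]
  choose f hf using hquot
  have key : ∀ x, ContMDiffAt 𝓘(ℝ, E) 𝓘(ℝ, ℂ) ∞ f x ∧ ∀ v, J.delbarFun f x v = 0 := by
    intro x
    obtain ⟨U, Ω, hx, hΩ⟩ := J.exists_isLocalFrame_of_ne_zero hl (hσ0 x)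
    obtain ⟨g, hgs, hgσ, hg⟩ := hσ U Ω hΩ
    obtain ⟨h, hhs, hhτ, hh⟩ := hτ U Ω hΩ
    have hg0 : ∀ y ∈ U, g y ≠ 0 := fun y hy h0 => hσ0 y (by rw [hgσ y hy, h0, zero_smul])
    have hU : U ∈ 𝓝 x := hΩ.isOpen.mem_nhds hx
    have hmul : ∀ y ∈ U, h y = f y * g y := by
      intro y hy
      have h1 := hf y
      rw [hgσ y hy, hhτ y hy, smul_smul] at h1
      exact CanonicalFiber.smul_tprod_cancel (hΩ.ne_zero y hy) h1
    have hgx := hgs.contMDiffAt hU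
    have hfx : ContMDiffAt 𝓘(ℝ, E) 𝓘(ℝ, ℂ) ∞ f x := by
      have hdiv : ContDiffAt ℝ ∞ (fun z : ℂ × ℂ => z.1 * z.2⁻¹) (h x, g x) :=
        contDiffAt_fst.mul (contDiffAt_snd.inv (hg0 x hx))
      refine (hdiv.comp_contMDiffAt (f := fun y => (h y, g y)) (x := x)
        ((hhs.contMDiffAt hU).prodMk_space hgx)).congr_of_eventuallyEq ?_
      filter_upwards [hU] with y hy
      simp only [Function.comp_apply]
      rw [hmul y hy, mul_inv_cancel_right₀ (hg0 y hy)]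
    refine ⟨hfx, ?_⟩
    refine eq_zero_of_oneFormWedge_eq_zero (Ω x).2 (fun h0 => hΩ.ne_zero x hx (Subtype.ext h0))
      (J.delbarFun_apply_toFun f x) fun v => ?_
    have hw : oneFormWedge (J.delbarFun h x) (Ω x).1 v =
        f x * oneFormWedge (J.delbarFun g x) (Ω x).1 v +
          g x * oneFormWedge (J.delbarFun f x) (Ω x).1 v := by
      have h1 : ∀ u, J.delbarFun h x u = f x * J.delbarFun g x u + g x * J.delbarFun f x u := by
        intro u
        rw [J.delbarFun_congr (g := fun y => f y * g y) (Filter.mem_of_superset hU hmul),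
          J.delbarFun_mul (hfx.mdifferentiableAt (by simp)) (hgx.mdifferentiableAt (by simp))]
      simp only [oneFormWedge, h1, Finset.mul_sum, ← Finset.sum_add_distrib]
      exact Finset.sum_congr rfl fun i _ => by ring
    have e1 := hg x hx v
    have e2 := hh x hx v
    rw [hw, hmul x hx] at e2
    have e3 : g x * oneFormWedge (J.delbarFun f x) (Ω x).1 v = 0 := by
      linear_combination e2 - f x * e1
    exact (mul_eq_zero.1 e3).resolve_left (hg0 x hx)
  obtain ⟨c, hc⟩ := J.eq_const_of_delbarFun_eq_zero (fun x => (key x).1) fun x => (key x).2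
  exact ⟨c, funext fun x => by rw [hf x, hc x, Pi.smul_apply]⟩

/-- If some `K_J^{⊗ l}` is pseudoholomorphically trivial, then every nonzero pseudoholomorphic
section of any `K_J^{⊗ n}` vanishes nowhere: its `l`-th power is a multiple of the `n`-th power of
the trivializing section. -/
theorem ne_zero_of_isPseudoholomorphicallyTrivial [FiniteDimensional ℝ E] [CompactSpace M]
    [ConnectedSpace M] {m : ℕ} (J : AlmostComplexStructure E M) {l : ℕ} (hl : 1 ≤ l)
    (htriv : J.IsPseudoholomorphicallyTrivial m l) {n : ℕ} (hn : 1 ≤ n)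
    {τ : Π x : M, J.PluricanonicalFiber m n x} (hτ : τ ∈ J.pseudoholomorphicSections m n)
    (hτ0 : τ ≠ 0) (x : M) : τ x ≠ 0 := by
  obtain ⟨σ, hσ, hσ0⟩ := htriv
  have hpow_ne : ∀ {j k i : ℕ} {υ : Π x : M, J.PluricanonicalFiber m j x}
      {ρ : Π x : M, J.PluricanonicalFiber m i x}, 1 ≤ j → υ ∈ J.pseudoholomorphicSections m j →
      (∀ (x : M) (c : ℂ) (a : J.CanonicalFiber m x),
        υ x = c • PiTensorProduct.tprod ℂ (fun _ : Fin j => a) →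
          ρ x = c ^ k • PiTensorProduct.tprod ℂ (fun _ : Fin i => a)) →
      ∀ x, υ x ≠ 0 → ρ x ≠ 0 := by
    intro j k i υ ρ hj hυ hρ x hx
    obtain ⟨U, Ω, hxU, hΩ⟩ := J.exists_isLocalFrame_of_ne_zero hj hx
    obtain ⟨f, -, hf, -⟩ := hυ U Ω hΩ
    have hf0 : f x ≠ 0 := fun h0 => hx (by rw [hf x hxU, h0, zero_smul])
    rw [hρ x _ _ (hf x hxU)]
    exact CanonicalFiber.smul_tprod_ne_zero (hΩ.ne_zero x hxU) (pow_ne_zero _ hf0)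
  obtain ⟨s, hs, hsσ⟩ := J.exists_pow_mem (n := l * n) rfl (by omega) hσ
  obtain ⟨ρ, hρ, hρτ⟩ := J.exists_pow_mem (n := l * n) (mul_comm l n) (by omega) hτ
  have hs0 : ∀ x, s x ≠ 0 := fun x => hpow_ne hl hσ hsσ x (hσ0 x)
  obtain ⟨c, rfl⟩ := J.exists_eq_smul_of_ne_zero (Nat.mul_pos hl hn) hs hρ hs0
  obtain ⟨y, hy⟩ := Function.ne_iff.1 hτ0
  have hc : c ≠ 0 := by
    rintro rfl
    exact hpow_ne hn hτ hρτ y hy (by simp)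
  intro hx
  have h1 := hρτ x 0 0 (by rw [hx, zero_smul])
  rw [zero_pow (by omega), zero_smul, Pi.smul_apply] at h1
  -- cancel the nonzero factor `c`
  refine hs0 x ?_
  rw [← one_smul ℂ (s x), ← inv_mul_cancel₀ hc, mul_smul, h1, smul_zero]

theorem rank_pseudoholomorphicSections_le_one [FiniteDimensional ℝ E] [CompactSpace M]
    [ConnectedSpace M] {m : ℕ} (J : AlmostComplexStructure E M) {l : ℕ} (hl : 1 ≤ l)
    (htriv : J.IsPseudoholomorphicallyTrivial m l) {n : ℕ} (hn : 1 ≤ n) :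
    Module.rank ℂ (J.pseudoholomorphicSections m n) ≤ 1 := by
  obtain ⟨τ, hτ⟩ : ∃ τ : J.pseudoholomorphicSections m n,
      ∀ υ : J.pseudoholomorphicSections m n, ∃ c : ℂ, c • τ = υ := by
    by_cases h : ∃ τ ∈ J.pseudoholomorphicSections m n, τ ≠ 0
    · obtain ⟨τ, hτ, hτ0⟩ := h
      refine ⟨⟨τ, hτ⟩, fun υ => ?_⟩
      obtain ⟨c, hc⟩ := J.exists_eq_smul_of_ne_zero hn hτ υ.2
        (J.ne_zero_of_isPseudoholomorphicallyTrivial hl htriv hn hτ hτ0)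
      exact ⟨c, Subtype.ext hc.symm⟩
    · push Not at h
      exact ⟨0, fun υ => ⟨0, Subtype.ext ((smul_zero (0 : ℂ)).trans (h υ.1 υ.2).symm)⟩⟩
  exact rank_le_one τ hτ

/-- On a compact connected almost complex manifold, pseudoholomorphic triviality of some power of
the canonical bundle implies Kodaira dimension `0`. -/
theorem kodairaDimension_eq_zero [FiniteDimensional ℝ E] [CompactSpace M] [ConnectedSpace M]
    {m : ℕ} (J : AlmostComplexStructure E M) {l : ℕ} (hl : 1 ≤ l)
    (htriv : J.IsPseudoholomorphicallyTrivial m l) : J.kodairaDimension m = 0 := by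
  obtain ⟨σ, hσ, hσ0⟩ := id htriv
  obtain ⟨x₀⟩ := (inferInstance : Nonempty M)
  -- the powers of the trivializing section are nonzero
  have hrank : ∀ k : ℕ, k ≠ 0 → Module.rank ℂ (J.pseudoholomorphicSections m (l * k)) = 1 := by
    intro k hk
    refine le_antisymm (J.rank_pseudoholomorphicSections_le_one hl htriv
      (Nat.mul_pos hl (Nat.pos_of_ne_zero hk))) ?_
    obtain ⟨ρ, hρ, hρσ⟩ := J.exists_pow_mem (n := l * k) rfl hk hσ
    obtain ⟨U, Ω, hxU, hΩ⟩ := J.exists_isLocalFrame_of_ne_zero hl (hσ0 x₀)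
    obtain ⟨f, -, hf, -⟩ := hσ U Ω hΩ
    have hf0 : f x₀ ≠ 0 := fun h0 => hσ0 x₀ (by rw [hf x₀ hxU, h0, zero_smul])
    refine Module.one_le_rank_iff.2 ⟨LinearMap.toSpanSingleton ℂ _ ⟨ρ, hρ⟩, fun c d hcd => ?_⟩
    have h1 : c • ρ x₀ = d • ρ x₀ := congrFun (congrArg Subtype.val hcd) x₀
    rw [hρσ x₀ _ _ (hf x₀ hxU), smul_smul, smul_smul] at h1
    exact mul_right_cancel₀ (pow_ne_zero k hf0)
      (CanonicalFiber.smul_tprod_cancel (hΩ.ne_zero x₀ hxU) h1)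
  have hne : ¬ ∀ n : ℕ, 1 ≤ n → J.pseudoholomorphicSections m n = ⊥ := by
    intro h
    rw [h l hl, Submodule.mem_bot] at hσ
    exact hσ0 x₀ (congrFun hσ x₀)
  rw [kodairaDimension, if_neg hne]
  apply le_antisymm
  · refine Filter.limsup_le_of_le (by isBoundedDefault) ?_
    filter_upwards [Filter.eventually_ge_atTop 1] with n hn
    have h1 : (Cardinal.toENat (Module.rank ℂ (J.pseudoholomorphicSections m n)) : ℕ∞) ≤ 1 := by
      simpa using OrderHomClass.mono Cardinal.toENat
        (J.rank_pseudoholomorphicSections_le_one hl htriv hn)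
    have h2 : ((Cardinal.toENat (Module.rank ℂ (J.pseudoholomorphicSections m n)) : ℕ∞) : ENNReal)
        ≤ 1 := by exact_mod_cast h1
    have h3 := ENNReal.log_monotone h2
    rw [ENNReal.log_one] at h3
    exact EReal.div_nonpos_of_nonpos_of_nonneg h3
      (EReal.coe_nonneg.2 (Real.log_natCast_nonneg n))
  · refine Filter.le_limsup_of_frequently_le ?_ (by isBoundedDefault)
    refine Filter.frequently_atTop.2 fun N => ⟨l * (N + 1), ?_, ?_⟩
    · nlinarith
    · rw [hrank (N + 1) (by omega)]
      simp

end AlmostComplexStructure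

end Sections

theorem mainTheorem5
    {E : Type*} [NormedAddCommGroup E] [NormedSpace ℝ E] [FiniteDimensional ℝ E]
    (m : ℕ) (hm : Module.finrank ℝ E = 2 * m)
    {G : Type*} [Group G] [TopologicalSpace G] [T2Space G] [ConnectedSpace G]
    [ChartedSpace E G] [LieGroup 𝓘(ℝ, E) ∞ G]
    (Γ : Subgroup G) [DiscreteTopology Γ] [CompactSpace (LieQuotient E Γ)]
    (J : AlmostComplexStructure E (LieQuotient E Γ)) (hJ : LieQuotient.IsInvariant J)
    (htriv : ∃ l : ℕ, 1 ≤ l ∧ J.IsPseudoholomorphicallyTrivial m l) :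
    J.kodairaDimension m = 0 := by
  obtain ⟨l, hl, hl'⟩ := htriv
  have : ConnectedSpace (LieQuotient E Γ) :=
    (LieQuotient.proj_surjective E Γ).connectedSpace
      (LieQuotient.isLocalHomeomorph_proj E Γ).continuous
  exact J.kodairaDimension_eq_zero hl hl'
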